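/- Let $\tau$ be the tautological line bundle over $\mathbb{CP}^1$ with the Hermitian metric induced from $\mathbb{C}^2$ and its Chern connection, and let $L=\tau^\vee$. Identify $S^2\cong\mathbb{CP}^1$ by $(\theta,\phi)\mapsto[\sin\frac\theta2e^{i\phi}:\cos\frac\theta2]$; the unit circle bundle of $\tau$ is the Hopf fibration $S^3\to S^2$. Give $S^2$ the area form $\frac12\sin\theta\,d\theta\wedge d\phi$ and the corresponding Kähler metric, i.e. one half of the round metric. Let $V_k=H^0(S^2,L^k)$, with inner product $\langle s,s'\rangle=\int_{S^2}(s(x),s'(x))_x\,\mathrm{vol}_x$, antilinear in the first slot. For $s\in V_k$ and $p\in S^3$ over $x$ write $s[p]=s(x)(p^{\otimes k})$. The coherent state $\psi_p^{(k)}\in V_k$ is the section with $\langle\psi_p^{(k)},s\rangle=s[p]$ for all $s\in V_k$. Let $\gamma,\sigma$ be closed $C^1$ curves in $S^2$, parametrized by arclength in the Kähler metric, of lengths $T$ and $S$, with parallel-transported lifts $\tilde\gamma,\tilde\sigma$ to $S^3$. Assume that both are Bohr–Sommerfeld loops, i.e. that their holonomies $\mathrm{Hol}(\gamma)=\tilde\gamma(T)/\tilde\gamma(0)$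 and $\mathrm{Hol}(\sigma)=\tilde\sigma(S)/\tilde\sigma(0)$ are roots of unity, and that they intersect transversally in finitely many points. For $k$ with $\mathrm{Hol}(\gamma)^k=\mathrm{Hol}(\sigma)^k=1$ put $$\Psi^{(k)}_{\tilde\gamma}=\int_0^T\psi^{(k)}_{\tilde\gamma(t)}\,dt,\qquad \Psi^{(k)}_{\tilde\sigma}=\int_0^S\psi^{(k)}_{\tilde\sigma(t)}\,dt .$$ **Theorem.** As $k\to\infty$ through the integers with $\mathrm{Hol}(\gamma)^k=\mathrm{Hol}(\sigma)^k=1$, $$\langle\Psi^{(k)}_{\tilde\gamma},\Psi^{(k)}_{\tilde\sigma}\rangle=\sqrt2\sum_{x\in\gamma\cap\sigma}\frac{\omega_x^k\,e^{i\,\mathrm{or}_x(\theta_x/2-\pi/4)}}{\sqrt{\sin\theta_x}}+o(1).$$ Here, at an intersection $x=\gamma(s)=\sigma(t)$, $\omega_x=\tilde\gamma(s)/\tilde\sigma(t)\in U(1)$, $\theta_x\in(0,\pi)$ is the angle between $\gamma'(s)$ and $\sigma'(t)$, and $\mathrm{or}_x=+1$ if rotating $\gamma'(s)$ to $\sigma'(t)$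 (through $\theta_x$) is counterclockwise as seen from outside $S^2$, and $-1$ otherwise. The sum runs over the pairs $(s,t)\in[0,T)\times[0,S)$ with $\gamma(s)=\sigma(t)$; if the loops have no self-intersections these are exactly the points of $\gamma\cap\sigma$. -/

import Mathlib

open Filter Topology
open scoped ComplexConjugate

noncomputable section

namespace LoopStates

/-- `ℝ³`, in which `S²` is the unit sphere. -/
abbrev R3 : Type := EuclideanSpace ℝ (Fin 3)

/-- `ℂ²` with its Hermitian inner product, antilinear in the first slot; `S³` is its unit sphere. -/
abbrev C2 : Type := EuclideanSpace ℂ (Fin 2)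

/-- The Hopf map. On `S³` it is the projection `S³ → S² ≅ ℂP¹` onto the base of the unit circle
bundle of the tautological line bundle `τ`; the point of `S²` with polar angle `θ` and azimuth `φ`
corresponds to the line through `(sin (θ/2) e^{iφ}, cos (θ/2))`. -/
def hopf (q : C2) : R3 :=
  !₂[2 * (q 0 * conj (q 1)).re, 2 * (q 0 * conj (q 1)).im, ‖q 1‖ ^ 2 - ‖q 0‖ ^ 2]

/-- The unit vector `u(θ, φ)` in the line over the point of `S²` with polar angle `θ` and
azimuth `φ`. -/
def hopfSection (θ φ : ℝ) : C2 :=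
  !₂[(Real.sin (θ / 2) : ℂ) * Complex.exp (Complex.I * φ), (Real.cos (θ / 2) : ℂ)]

/-- `V_k = H⁰(ℂP¹, L^k)`, where `L` is the dual of the tautological bundle. A section `s` of `L^k` is
given by its values `s[q] = s(x)(q ⊗ ⋯ ⊗ q)` on the vectors `q` of the lines `x`, a function on
`ℂ²` which is homogeneous of degree `k`; the section is holomorphic if and only if this function is
holomorphic on `ℂ² ∖ {0}` (the complement of the zero section of `τ`). -/
def holSections (k : ℕ) : Submodule ℂ (C2 → ℂ) where
  carrier := {s | DifferentiableOn ℂ s {0}ᶜ ∧ ∀ (c : ℂ) (q : C2), s (c • q) = c ^ k * s q}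
  add_mem' := by
    rintro a b ⟨ha, ha'⟩ ⟨hb, hb'⟩
    refine ⟨ha.add hb, fun c q => ?_⟩
    simp only [Pi.add_apply, ha', hb', mul_add]
  zero_mem' := ⟨differentiableOn_const 0, fun c q => by simp⟩
  smul_mem' := by
    rintro r a ⟨ha, ha'⟩
    refine ⟨ha.const_smul r, fun c q => ?_⟩
    simp only [Pi.smul_apply, ha', smul_eq_mul]
    ring

/-- The global inner product `⟨s, s'⟩ = ∫_{S²} (s(x), s'(x))_x vol_x`, antilinear in `s`.
The fibrewise inner product is `conj s[p] * s'[p]` for any unit vector `p` over `x`, and the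
volume form is the Fubini–Study form `½ sin θ dθ ∧ dφ`, of total area `2π`. -/
def globalInner (s s' : C2 → ℂ) : ℂ :=
  ∫ θ in (0 : ℝ)..Real.pi, ∫ φ in (0 : ℝ)..(2 * Real.pi),
    conj (s (hopfSection θ φ)) * s' (hopfSection θ φ) * ((Real.sin θ / 2 : ℝ) : ℂ)

/-- `ψ ∈ V_k` represents the evaluation functional `s ↦ s[p]` on `V_k`. -/
def IsCoherentState (k : ℕ) (p : C2) (ψ : holSections k) : Prop :=
  ∀ s : holSections k, globalInner (ψ : C2 → ℂ) (s : C2 → ℂ) = (s : C2 → ℂ) p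

open Classical in
/-- The coherent state `ψ_p^{(k)}`: the (unique) element of `V_k` representing evaluation at `p`. -/
def coherentState (k : ℕ) (p : C2) : holSections k :=
  if h : ∃ ψ : holSections k, IsCoherentState k p ψ then h.choose else 0

/-- The length of a tangent vector `v` of `S² ⊆ ℝ³` in the Kähler metric whose area form is
`½ sin θ dθ ∧ dφ`, which is one half of the round metric of the unit sphere. -/
def kahlerLength (v : R3) : ℝ := ‖v‖ / √2

/-- `γ` is a closed `C¹` curve in `S²`, of length `T`, parametrized by arclength in the Kähler
metric; it is given as a `T`-periodic function on `ℝ`. -/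
structure IsArclengthLoop (γ : ℝ → R3) (T : ℝ) : Prop where
  length_pos : 0 < T
  periodic : Function.Periodic γ T
  contDiff : ContDiff ℝ 1 γ
  mem_sphere : ∀ t, ‖γ t‖ = 1
  unit_speed : ∀ t, kahlerLength (deriv γ t) = 1

/-- `γt` is a lift of `γ` to `S³`, parallel for the Chern connection of `τ`. That connection is
the orthogonal projection of the derivative in `ℂ²` to the line, so that `γt` is parallel if and
only if its derivative is orthogonal to it. -/
structure IsParallelLift (γ : ℝ → R3) (γt : ℝ → C2) : Prop where
  contDiff : ContDiff ℝ 1 γt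
  mem_sphere : ∀ t, ‖γt t‖ = 1
  hopf_eq : ∀ t, hopf (γt t) = γ t
  horizontal : ∀ t, inner ℂ (γt t) (deriv γt t) = 0

/-- The quotient `p / q` of a vector `p` by a nonzero vector `q` of the same complex line: the
number `ω` with `p = ω • q`. -/
def lineRatio (p q : C2) : ℂ := inner ℂ q p / inner ℂ q q

/-- The holonomy `γt(T) / γt(0)` around a loop of length `T` with parallel lift `γt`. -/
def holonomy (γt : ℝ → C2) (T : ℝ) : ℂ := lineRatio (γt T) (γt 0)

/-- The orders `k` for which the loop of length `T` with parallel lift `γt` is Bohr–Sommerfeld. -/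
def bohrSommerfeldOrders (γt : ℝ → C2) (T : ℝ) : Set ℕ := {k | holonomy γt T ^ k = 1}

/-- The loop is Bohr–Sommerfeld: its holonomy is a root of unity. -/
def IsBohrSommerfeld (γt : ℝ → C2) (T : ℝ) : Prop :=
  ∃ k ∈ bohrSommerfeldOrders γt T, 0 < k

/-- The coherent loop state `Ψ^{(k)} = ∫₀ᵀ ψ^{(k)}_{γt(t)} dt`, given by its values. (An integral
in the finite-dimensional space `V_k` of functions can be computed pointwise.) -/
def loopState (k : ℕ) (γt : ℝ → C2) (T : ℝ) : C2 → ℂ :=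
  fun q => ∫ t in (0 : ℝ)..T, (coherentState k (γt t) : C2 → ℂ) q

/-- The intersections of two loops, as pairs of parameters. For loops without
self-intersections these correspond bijectively to the points of `γ ∩ σ`. -/
def intersections (γ : ℝ → R3) (T : ℝ) (σ : ℝ → R3) (S : ℝ) : Set (ℝ × ℝ) :=
  {x | x.1 ∈ Set.Ico 0 T ∧ x.2 ∈ Set.Ico 0 S ∧ γ x.1 = σ x.2}

/-- The orientation `±1` of the angle from `v` to `w` in the tangent plane of `S²` at `x`: it is `+1`
if rotating `v` to `w` is counterclockwise when viewed from outside `S²`, that is, if `(x, v, w)`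
is a positively oriented basis of `ℝ³`. -/
def orientationSign (x v w : R3) : ℝ :=
  if 0 < Matrix.det !![x 0, x 1, x 2; v 0, v 1, v 2; w 0, w 1, w 2] then 1 else -1

/-- The contribution `ω_x^k e^{i or_x (θ_x / 2 - π / 4)} / √(sin θ_x)` of the intersection `γ(s) = σ(t)`.
The Kähler metric is conformal to the round one, so angles are those of `ℝ³`. -/
def contribution (k : ℕ) (γ : ℝ → R3) (γt : ℝ → C2) (σ : ℝ → R3) (σt : ℝ → C2) (s t : ℝ) : ℂ :=
  let ω : ℂ := lineRatio (γt s) (σt t)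
  let θ : ℝ := InnerProductGeometry.angle (deriv γ s) (deriv σ t)
  let o : ℝ := orientationSign (γ s) (deriv γ s) (deriv σ t)
  ω ^ k * Complex.exp (Complex.I * ((o * (θ / 2 - Real.pi / 4) : ℝ) : ℂ)) / ((√(Real.sin θ) : ℝ) : ℂ)

end LoopStates

end

/-!
The section `ψ_p` is the reproducing kernel `q ↦ (k + 1) / (2π) ⟨p, q⟩ᵏ`: sections of `Lᵏ` are
homogeneous polynomials of degree `k` (`exists_eq_homPoly`), and monomials are orthogonal with
norms given by beta integrals (`globalInner_homPoly`). Hence the pairing of the two loop states is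

  `(k + 1) / (2π) ∫∫ F(s, t)ᵏ dt ds`, with `F(s, t) = ⟨σt(t), γt(s)⟩` (`globalInner_loopState`),

and the theorem is Laplace's method for this double integral.

By Cauchy–Schwarz `|F| ≤ 1`, with equality exactly where `γt(s)` and `σt(t)` lie on one complex line,
that is, at the intersections. There, after replacing `σt` by `ω σt` so that the two lifts agree,
`F / ω = 1 - (s² + t²) / 4 + m s t + o(s² + t²)`, where `m` is the inner product of the velocities
of the lifts (`isLittleO_inner_sub_crossingForm`). The curves are only `C¹`, and the second-order
expansion is due to parallelism: the derivative of `⟨γt(0), γt(s)⟩` is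
`-⟨γt(s) - γt(0), γt'(s)⟩ = -s / 2 + o(s)`.

The Hopf map is conformal with factor `2` and orientation preserving on horizontal vectors
(`inner_hopfDeriv`, `det_hopfDeriv`), so `2m = exp (-i or_x θ_x)`; transversality makes the real part
of the quadratic form negative definite. Rescaling by `√k`, dominated convergence
(`tendsto_integral_pow_sub_sum`) replaces `k ∫∫ Fᵏ` near the intersection by `ωᵏ` times the Gaussian
integral `4π / √(1 - 4m²)` (`integral_exp_crossingForm`). The branch of the root gives the phase
`exp (i or_x (θ_x / 2 - π / 4))`.

Intersections at the boundary of the parameter rectangle are avoided by shifting it slightly. This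
changes nothing for Bohr–Sommerfeld orders `k`, for which `Fᵏ` is doubly periodic
(`IsParallelLift.add_period`).
-/

noncomputable section

namespace LoopStates

open MeasureTheory Asymptotics

/-! ### Holomorphic sections and coherent states -/

/-- The homogeneous polynomial `∑ aⱼ q₀ʲ q₁ᵏ⁻ʲ` of degree `k` with coefficients `a`. -/
def homPoly (k : ℕ) (a : ℕ → ℂ) (q : C2) : ℂ :=
  ∑ j ∈ Finset.range (k + 1), a j * (q 0 ^ j * q 1 ^ (k - j))

lemma homPoly_smul (k : ℕ) (a : ℕ → ℂ) (c : ℂ) (q : C2) :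
    homPoly k a (c • q) = c ^ k * homPoly k a q := by
  simp only [homPoly, Finset.mul_sum]
  refine Finset.sum_congr rfl fun j hj => ?_
  have hj' : j ≤ k := Nat.lt_succ_iff.mp (Finset.mem_range.mp hj)
  simp only [PiLp.smul_apply, smul_eq_mul, mul_pow]
  conv_rhs => rw [← Nat.add_sub_cancel' hj', pow_add, Nat.add_sub_cancel' hj']
  ring

lemma continuous_homPoly (k : ℕ) (a : ℕ → ℂ) : Continuous (homPoly k a) := by
  unfold homPoly
  fun_prop

lemma homPoly_mem (k : ℕ) (a : ℕ → ℂ) : homPoly k a ∈ holSections k := by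
  refine ⟨Differentiable.differentiableOn ?_, homPoly_smul k a⟩
  unfold homPoly
  have h0 : Differentiable ℂ fun q : C2 => q 0 :=
    (EuclideanSpace.proj (𝕜 := ℂ) (0 : Fin 2)).differentiable
  have h1 : Differentiable ℂ fun q : C2 => q 1 :=
    (EuclideanSpace.proj (𝕜 := ℂ) (1 : Fin 2)).differentiable
  fun_prop

/-- An entire function of growth `O(|z|ᵏ)` is a polynomial of degree at most `k`, by the Cauchy
estimates for its Taylor coefficients. -/
lemma entire_eq_polynomial_of_growth {f : ℂ → ℂ} (hf : Differentiable ℂ f) (k : ℕ) (M : ℝ)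
    (hM : ∀ z : ℂ, 1 ≤ ‖z‖ → ‖f z‖ ≤ M * ‖z‖ ^ k) :
    ∃ a : ℕ → ℂ, ∀ z, f z = ∑ j ∈ Finset.range (k + 1), a j * z ^ j := by
  have hzero : ∀ n, k < n → iteratedDeriv n f 0 = 0 := by
    intro n hn
    have hb : ∀ᶠ R : ℝ in atTop, ‖iteratedDeriv n f 0‖ ≤ n.factorial * M * R⁻¹ ^ (n - k) := by
      filter_upwards [eventually_ge_atTop (1 : ℝ)] with R hR
      have hR0 : 0 < R := by linarith
      refine (Complex.norm_iteratedDeriv_le_of_forall_mem_sphere_norm_le (C := M * R ^ k) n hR0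
        hf.diffContOnCl ?_).trans_eq ?_
      · intro z hz
        have hz' : ‖z‖ = R := by simpa using hz
        simpa [hz'] using hM z (by rw [hz']; exact hR)
      · obtain ⟨d, rfl⟩ := Nat.exists_eq_add_of_lt hn
        have : k + d + 1 - k = d + 1 := by omega
        rw [this, show k + d + 1 = k + (d + 1) by ring, pow_add, inv_pow]
        field_simp
    have hlim : Tendsto (fun R : ℝ => n.factorial * M * R⁻¹ ^ (n - k)) atTop (𝓝 0) := by
      have h1 := (tendsto_inv_atTop_zero (𝕜 := ℝ)).pow (n - k)
      rw [zero_pow (by omega)] at h1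
      simpa using h1.const_mul (n.factorial * M)
    exact norm_le_zero_iff.mp (ge_of_tendsto hlim hb)
  refine ⟨fun j => (j.factorial : ℂ)⁻¹ * iteratedDeriv j f 0, fun z => ?_⟩
  have h := Complex.hasSum_taylorSeries_of_entire hf 0 z
  rw [h.unique (hasSum_sum_of_ne_finset_zero (s := Finset.range (k + 1)) ?_)]
  · refine Finset.sum_congr rfl fun j _ => ?_
    simp only [sub_zero, smul_eq_mul]
    ring
  · intro j hj
    rw [hzero j (not_le.mp fun h' => hj (Finset.mem_range.mpr (Nat.lt_succ_of_le h')))]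
    simp

/-- Global holomorphic sections of `Lᵏ` are homogeneous polynomials of degree `k`: in the affine
chart the section is an entire function, and the other chart bounds its growth by `|z|ᵏ`. -/
lemma exists_eq_homPoly {k : ℕ} {s : C2 → ℂ} (hs : s ∈ holSections k) :
    ∃ a : ℕ → ℂ, s = homPoly k a := by
  obtain ⟨hd, hh⟩ := hs
  have hopen : IsOpen ({0}ᶜ : Set C2) := isOpen_compl_singleton
  have hne : ∀ z w : ℂ, (z ≠ 0 ∨ w ≠ 0) → (!₂[z, w] : C2) ∈ ({0}ᶜ : Set C2) := by
    intro z w h h0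
    rw [Set.mem_singleton_iff] at h0
    have e0 := congrArg (fun q : C2 => q 0) h0
    have e1 := congrArg (fun q : C2 => q 1) h0
    simp at e0 e1
    tauto
  have hcurve0 : Differentiable ℂ fun z : ℂ => (!₂[z, 1] : C2) := by
    rw [differentiable_euclidean]
    intro i
    fin_cases i <;> simp
  have hcurve1 : Differentiable ℂ fun z : ℂ => (!₂[1, z] : C2) := by
    rw [differentiable_euclidean]
    intro i
    fin_cases i <;> simp
  have hf : Differentiable ℂ fun z : ℂ => s !₂[z, 1] := fun z =>
    DifferentiableAt.comp z (hd.differentiableAt (hopen.mem_nhds (hne z 1 (by simp)))) (hcurve0 z)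
  have hg : Differentiable ℂ fun z : ℂ => s !₂[1, z] := fun z =>
    DifferentiableAt.comp z (hd.differentiableAt (hopen.mem_nhds (hne 1 z (by simp)))) (hcurve1 z)
  obtain ⟨M, hM⟩ := (isCompact_closedBall (0 : ℂ) 1).exists_bound_of_continuousOn
    hg.continuous.continuousOn
  obtain ⟨a, ha⟩ := entire_eq_polynomial_of_growth hf k M (by
    intro z hz
    have hz0 : z ≠ 0 := norm_pos_iff.mp (by linarith)
    have : (!₂[z, 1] : C2) = z • !₂[1, z⁻¹] := by
      ext i; fin_cases i <;> simp [hz0]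
    rw [this, hh, norm_mul, norm_pow, mul_comm]
    gcongr
    apply hM
    simp [inv_le_one_of_one_le₀ hz])
  have hgen : ∀ q : C2, q 1 ≠ 0 → s q = homPoly k a q := by
    intro q hq
    have : q = q 1 • (!₂[q 0 / q 1, 1] : C2) := by
      ext i; fin_cases i <;> simp; field_simp
    rw [this, hh, homPoly_smul, ha]
    simp [homPoly]
  have hax : ∀ q : C2, q ≠ 0 → s q = homPoly k a q := by
    intro q hq
    by_cases h1 : q 1 = 0
    swap
    · exact hgen q h1
    have hq2 : q = !₂[q 0, 0] := by
      ext i; fin_cases i <;> simp [h1]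
    have hcurve : Continuous fun w : ℂ => (!₂[q 0, w] : C2) := by
      have : Differentiable ℂ fun w : ℂ => (!₂[q 0, w] : C2) := by
        rw [differentiable_euclidean]
        intro i
        fin_cases i <;> simp
      exact this.continuous
    have c1 : Tendsto (fun w : ℂ => s !₂[q 0, w]) (𝓝[≠] 0) (𝓝 (s q)) := by
      have h2 : ContinuousAt s (!₂[q 0, 0]) := by
        rw [← hq2]
        exact (hd.differentiableAt (hopen.mem_nhds hq)).continuousAt
      have h3 : ContinuousAt (fun w : ℂ => s !₂[q 0, w]) 0 :=
        ContinuousAt.comp (g := s) h2 hcurve.continuousAt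
      have h4 := h3.tendsto.mono_left (nhdsWithin_le_nhds (s := {0}ᶜ))
      rwa [← hq2] at h4
    have c2 : Tendsto (fun w : ℂ => homPoly k a !₂[q 0, w]) (𝓝[≠] 0) (𝓝 (homPoly k a q)) := by
      have h4 := (((continuous_homPoly k a).comp hcurve).tendsto 0).mono_left
        (nhdsWithin_le_nhds (s := {0}ᶜ))
      simp only [Function.comp_def] at h4
      rwa [← hq2] at h4
    refine tendsto_nhds_unique c1 (c2.congr' ?_)
    filter_upwards [self_mem_nhdsWithin] with w hw
    exact (hgen _ (by simpa using hw)).symm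
  refine ⟨a, funext fun q => ?_⟩
  by_cases hq : q = 0
  · have : q = (0 : ℂ) • (!₂[1, 1] : C2) := by simp [hq]
    rw [this, hh, homPoly_smul, hgen _ (by simp)]
  · exact hax q hq

lemma integral_pow_mul_one_sub_pow (j m : ℕ) :
    ∫ u in (0 : ℝ)..1, u ^ j * (1 - u) ^ m
      = ((j.factorial * m.factorial : ℕ) : ℝ) / (j + m + 1).factorial := by
  have h := Complex.Gamma_mul_Gamma_eq_betaIntegral (s := j + 1) (t := m + 1)
    (by simp; positivity) (by simp; positivity)
  have h2 : (j + 1 + (m + 1) : ℂ) = ((j + m + 1 : ℕ) : ℂ) + 1 := by push_cast; ring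
  rw [h2, Complex.Gamma_nat_eq_factorial, Complex.Gamma_nat_eq_factorial,
    Complex.Gamma_nat_eq_factorial, Complex.betaIntegral] at h
  simp only [add_sub_cancel_right, Complex.cpow_natCast] at h
  have h3 : ∫ x in (0 : ℝ)..1, ((x : ℂ) ^ j * (1 - (x : ℂ)) ^ m)
      = ((∫ x in (0 : ℝ)..1, x ^ j * (1 - x) ^ m : ℝ) : ℂ) := by
    rw [← intervalIntegral.integral_ofReal]
    push_cast
    rfl
  rw [h3] at h
  have h4 : ((j.factorial * m.factorial : ℕ) : ℝ)
      = ((j + m + 1).factorial : ℝ) * ∫ x in (0 : ℝ)..1, x ^ j * (1 - x) ^ m := by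
    exact_mod_cast h
  rw [h4, mul_div_cancel_left₀]
  positivity

/-- The substitution `u = sin² (θ / 2)` turns the polar integral into a beta integral. -/
lemma integral_polar (k j : ℕ) (hj : j ≤ k) :
    ∫ θ in (0 : ℝ)..Real.pi, (Real.sin (θ / 2) ^ 2) ^ j * (Real.cos (θ / 2) ^ 2) ^ (k - j)
        * (Real.sin θ / 2) = (1 / ((k + 1) * k.choose j) : ℝ) := by
  have hder : ∀ θ : ℝ, HasDerivAt (fun θ => Real.sin (θ / 2) ^ 2) (Real.sin θ / 2) θ := by
    intro θ
    have h1 : HasDerivAt (fun θ : ℝ => θ / 2) (1 / 2) θ := (hasDerivAt_id θ).div_const 2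
    convert! (h1.sin.pow 2) using 1
    have : Real.sin θ = 2 * Real.sin (θ / 2) * Real.cos (θ / 2) := by
      rw [← Real.sin_two_mul]; ring_nf
    rw [this]
    simp
    ring
  have h := intervalIntegral.integral_comp_mul_deriv (a := 0) (b := Real.pi)
    (f := fun θ => Real.sin (θ / 2) ^ 2) (f' := fun θ => Real.sin θ / 2)
    (g := fun u => u ^ j * (1 - u) ^ (k - j)) (fun θ _ => hder θ)
    (by fun_prop) (by fun_prop)
  simp only [Function.comp_def, zero_div, Real.sin_zero, Real.sin_pi_div_two] at h
  norm_num only [one_pow] at h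
  rw [integral_pow_mul_one_sub_pow] at h
  have hc : ∀ θ : ℝ, Real.cos (θ / 2) ^ 2 = 1 - Real.sin (θ / 2) ^ 2 := fun θ => by
    linarith [Real.sin_sq_add_cos_sq (θ / 2)]
  simp only [hc]
  refine h.trans ?_
  have h2 : (k.choose j : ℝ) * j.factorial * (k - j).factorial = k.factorial := by
    exact_mod_cast Nat.choose_mul_factorial_mul_factorial hj
  rw [Nat.add_sub_cancel' hj, Nat.factorial_succ]
  have h3 : (k.choose j : ℝ) ≠ 0 := by exact_mod_cast (Nat.choose_pos hj).ne'
  push_cast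
  rw [← h2]
  have := Nat.factorial_ne_zero j
  have := Nat.factorial_ne_zero (k - j)
  have : (k + 1 : ℝ) ≠ 0 := by positivity
  field_simp

lemma integral_exp_int_mul (i j : ℕ) :
    ∫ φ in (0 : ℝ)..(2 * Real.pi), Complex.exp (Complex.I * φ * ((j : ℂ) - i))
      = if i = j then 2 * (Real.pi : ℂ) else 0 := by
  split_ifs with h
  · simp [h]
  · have hne : ((j : ℂ) - i) ≠ 0 := sub_ne_zero.mpr (by exact_mod_cast Ne.symm h)
    have := integral_exp_mul_complex (a := 0) (b := 2 * Real.pi) (c := Complex.I * ((j : ℂ) - i))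
      (mul_ne_zero Complex.I_ne_zero hne)
    have e : ∀ φ : ℝ, Complex.I * φ * ((j : ℂ) - i) = Complex.I * ((j : ℂ) - i) * φ :=
      fun φ => by ring
    simp only [e, this]
    have : Complex.exp (Complex.I * ((j : ℂ) - i) * ((2 * Real.pi : ℝ) : ℂ)) = 1 := by
      rw [Complex.exp_eq_one_iff]
      exact ⟨(j : ℤ) - i, by push_cast; ring⟩
    rw [this]
    simp

/-- The monomials `q₀ʲ q₁ᵏ⁻ʲ` are orthogonal, with square norm `2π / ((k + 1) (k choose j))`. -/
lemma globalInner_homPoly (k : ℕ) (a b : ℕ → ℂ) :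
    globalInner (homPoly k a) (homPoly k b)
      = ∑ j ∈ Finset.range (k + 1),
          conj (a j) * b j * (2 * Real.pi / ((k + 1) * k.choose j) : ℂ) := by
  have hin : ∀ θ : ℝ, ∫ φ in (0 : ℝ)..(2 * Real.pi),
      conj (homPoly k a (hopfSection θ φ)) * homPoly k b (hopfSection θ φ)
        * ((Real.sin θ / 2 : ℝ) : ℂ)
      = ∑ j ∈ Finset.range (k + 1), conj (a j) * b j * (2 * Real.pi) *
          (((Real.sin (θ / 2) ^ 2) ^ j * (Real.cos (θ / 2) ^ 2) ^ (k - j)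
            * (Real.sin θ / 2) : ℝ) : ℂ) := by
    intro θ
    have e : ∀ φ : ℝ, conj (homPoly k a (hopfSection θ φ)) * homPoly k b (hopfSection θ φ)
        * ((Real.sin θ / 2 : ℝ) : ℂ)
        = ∑ i ∈ Finset.range (k + 1), ∑ j ∈ Finset.range (k + 1),
          (conj (a i) * b j * (((Real.sin (θ / 2) ^ (i + j))
            * Real.cos (θ / 2) ^ ((k - i) + (k - j)) * (Real.sin θ / 2) : ℝ) : ℂ))
            * Complex.exp (Complex.I * φ * ((j : ℂ) - i)) := by
      intro φ
      simp only [homPoly, map_sum]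
      rw [Finset.sum_mul_sum, Finset.sum_mul]
      simp only [Finset.sum_mul]
      refine Finset.sum_congr rfl fun i _ => Finset.sum_congr rfl fun j _ => ?_
      have hexp : Complex.exp (Complex.I * φ * ((j : ℂ) - i))
          = conj (Complex.exp (Complex.I * φ)) ^ i * Complex.exp (Complex.I * φ) ^ j := by
        rw [← Complex.exp_conj, ← Complex.exp_nat_mul, ← Complex.exp_nat_mul, ← Complex.exp_add]
        congr 1
        simp
        ring
      rw [hexp]
      simp only [hopfSection, map_mul, map_pow, PiLp.toLp_apply, Matrix.cons_val_zero,
        Matrix.cons_val_one, Complex.conj_ofReal]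
      push_cast
      ring
    simp only [e]
    rw [intervalIntegral.integral_finsetSum]
    swap
    · intro i _
      apply Continuous.intervalIntegrable
      fun_prop
    refine Finset.sum_congr rfl fun i hi => ?_
    rw [intervalIntegral.integral_finsetSum]
    swap
    · intro i _
      apply Continuous.intervalIntegrable
      fun_prop
    simp only [intervalIntegral.integral_const_mul, integral_exp_int_mul, mul_ite, mul_zero]
    rw [Finset.sum_ite_eq, if_pos hi]
    push_cast
    ring
  simp only [globalInner, hin]
  rw [intervalIntegral.integral_finsetSum]
  swap
  · intro i _
    apply Continuous.intervalIntegrable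
    fun_prop
  refine Finset.sum_congr rfl fun j hj => ?_
  rw [intervalIntegral.integral_const_mul, intervalIntegral.integral_ofReal,
    integral_polar k j (Nat.lt_succ_iff.mp (Finset.mem_range.mp hj))]
  push_cast
  ring

lemma globalInner_conj_symm (s s' : C2 → ℂ) : conj (globalInner s s') = globalInner s' s := by
  simp only [globalInner]
  rw [← intervalIntegral.intervalIntegral_conj]
  congr 1; ext θ
  rw [← intervalIntegral.intervalIntegral_conj]
  congr 1; ext φ
  simp only [map_mul, Complex.conj_conj, Complex.conj_ofReal]
  ring

/-- The coefficients of the reproducing kernel `q ↦ (k + 1) / (2π) ⟨p, q⟩ᵏ`. -/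
def kernelCoeff (k : ℕ) (p : C2) (j : ℕ) : ℂ :=
  (k + 1) / (2 * Real.pi) * k.choose j * (conj (p 0) ^ j * conj (p 1) ^ (k - j))

lemma homPoly_kernelCoeff (k : ℕ) (p q : C2) :
    homPoly k (kernelCoeff k p) q = (k + 1) / (2 * Real.pi) * inner ℂ p q ^ k := by
  have : (inner ℂ p q : ℂ) = q 0 * conj (p 0) + q 1 * conj (p 1) := by
    simp [PiLp.inner_apply, Fin.sum_univ_two]
  rw [this, add_pow, homPoly, Finset.mul_sum]
  refine Finset.sum_congr rfl fun j _ => ?_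
  simp only [kernelCoeff, mul_pow]
  ring

lemma globalInner_kernelCoeff (k : ℕ) (p : C2) (b : ℕ → ℂ) :
    globalInner (homPoly k (kernelCoeff k p)) (homPoly k b) = homPoly k b p := by
  rw [globalInner_homPoly, homPoly]
  refine Finset.sum_congr rfl fun j hj => ?_
  have h3 : (k.choose j : ℂ) ≠ 0 := by
    exact_mod_cast (Nat.choose_pos (Nat.lt_succ_iff.mp (Finset.mem_range.mp hj))).ne'
  have : (k + 1 : ℂ) ≠ 0 := by exact_mod_cast Nat.succ_ne_zero k
  have : (Real.pi : ℂ) ≠ 0 := by exact_mod_cast Real.pi_ne_zero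
  simp [kernelCoeff, Complex.conj_ofNat]
  field_simp

/-- The coherent state is `q ↦ (k + 1) / (2π) ⟨p, q⟩ᵏ`. Uniqueness of the representing section needs
no positivity: it follows by evaluating the reproducing property on the kernels themselves. -/
lemma coherentState_eq (k : ℕ) (p : C2) :
    (coherentState k p : C2 → ℂ) = homPoly k (kernelCoeff k p) := by
  have hrep : ∀ p, ∀ s : holSections k,
      globalInner (homPoly k (kernelCoeff k p)) (s : C2 → ℂ) = (s : C2 → ℂ) p := by
    intro p s
    obtain ⟨b, hb⟩ := exists_eq_homPoly s.2
    rw [hb, globalInner_kernelCoeff]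
  have hex : ∃ ψ : holSections k, IsCoherentState k p ψ :=
    ⟨⟨_, homPoly_mem k (kernelCoeff k p)⟩, hrep p⟩
  rw [coherentState, dif_pos hex]
  have hψ := hex.choose_spec
  set ψ := hex.choose
  ext q
  have h1 := hψ ⟨_, homPoly_mem k (kernelCoeff k q)⟩
  have h2 := hrep q ψ
  rw [← h2, ← globalInner_conj_symm, h1, homPoly_kernelCoeff]
  simp only [homPoly_kernelCoeff]
  simp [inner_conj_symm, Complex.conj_ofNat]

lemma loopState_eq (k : ℕ) {γt : ℝ → C2} (hγ : Continuous γt) (T : ℝ) :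
    loopState k γt T = homPoly k fun j => ∫ t in (0 : ℝ)..T, kernelCoeff k (γt t) j := by
  ext q
  simp only [loopState, coherentState_eq, homPoly]
  rw [intervalIntegral.integral_finsetSum]
  · simp only [intervalIntegral.integral_mul_const]
  · intro j _
    apply Continuous.intervalIntegrable
    unfold kernelCoeff
    fun_prop

/-- The pairing of two loop states as an oscillatory integral of the reproducing kernel. -/
lemma globalInner_loopState (k : ℕ) {γt σt : ℝ → C2} (hγ : Continuous γt) (hσ : Continuous σt)
    (T S : ℝ) :
    globalInner (loopState k γt T) (loopState k σt S)
      = (k + 1) / (2 * Real.pi) *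
        ∫ s in (0 : ℝ)..T, ∫ t in (0 : ℝ)..S, (inner ℂ (σt t) (γt s) : ℂ) ^ k := by
  rw [loopState_eq k hγ, loopState_eq k hσ, globalInner_homPoly]
  have h : ∀ s t, (k + 1) / (2 * Real.pi) * (inner ℂ (σt t) (γt s) : ℂ) ^ k
      = ∑ j ∈ Finset.range (k + 1), conj (kernelCoeff k (γt s) j)
        * (2 * Real.pi / ((k + 1) * k.choose j) : ℂ) * kernelCoeff k (σt t) j := by
    intro s t
    rw [← homPoly_kernelCoeff, homPoly]
    refine Finset.sum_congr rfl fun j hj => ?_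
    have h3 : (k.choose j : ℂ) ≠ 0 := by
      exact_mod_cast (Nat.choose_pos (Nat.lt_succ_iff.mp (Finset.mem_range.mp hj))).ne'
    have : (k + 1 : ℂ) ≠ 0 := by exact_mod_cast Nat.succ_ne_zero k
    have : (Real.pi : ℂ) ≠ 0 := by exact_mod_cast Real.pi_ne_zero
    simp [kernelCoeff, Complex.conj_ofNat]
    field_simp
  simp only [← intervalIntegral.integral_const_mul, h]
  have hs : ∀ s, ∫ t in (0 : ℝ)..S, ∑ j ∈ Finset.range (k + 1), conj (kernelCoeff k (γt s) j)
        * (2 * Real.pi / ((k + 1) * k.choose j) : ℂ) * kernelCoeff k (σt t) j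
      = ∑ j ∈ Finset.range (k + 1), conj (kernelCoeff k (γt s) j)
        * ((2 * Real.pi / ((k + 1) * k.choose j) : ℂ)
          * ∫ t in (0 : ℝ)..S, kernelCoeff k (σt t) j) := by
    intro s
    rw [intervalIntegral.integral_finsetSum]
    · simp only [intervalIntegral.integral_const_mul, mul_assoc]
    · intro j _
      apply Continuous.intervalIntegrable
      unfold kernelCoeff
      fun_prop
  simp only [hs]
  rw [intervalIntegral.integral_finsetSum]
  · refine Finset.sum_congr rfl fun j _ => ?_
    simp only [intervalIntegral.integral_const_mul]
    rw [intervalIntegral.integral_mul_const, intervalIntegral.intervalIntegral_conj]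
    ring
  · intro j _
    apply Continuous.intervalIntegrable
    unfold kernelCoeff
    fun_prop

/-! ### Laplace's method in two variables -/

lemma integrable_exp_neg_sq_norm {c : ℝ} (hc : 0 < c) :
    Integrable fun h : ℝ × ℝ => Real.exp (-c * ‖h‖ ^ 2) := by
  have h1 : Integrable fun h : ℝ × ℝ =>
      Real.exp (-(c / 2) * h.1 ^ 2) * Real.exp (-(c / 2) * h.2 ^ 2) :=
    (integrable_exp_neg_mul_sq (half_pos hc)).mul_prod (integrable_exp_neg_mul_sq (half_pos hc))
  refine h1.mono' (by fun_prop) (Eventually.of_forall fun h => ?_)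
  rw [Real.norm_eq_abs, Real.abs_exp, ← Real.exp_add, Real.exp_le_exp]
  have e1 : h.1 ^ 2 ≤ ‖h‖ ^ 2 := by
    rw [← sq_abs h.1]
    exact pow_le_pow_left₀ (abs_nonneg _) (norm_fst_le h) 2
  have e2 : h.2 ^ 2 ≤ ‖h‖ ^ 2 := by
    rw [← sq_abs h.2]
    exact pow_le_pow_left₀ (abs_nonneg _) (norm_snd_le h) 2
  nlinarith

lemma norm_one_add_le (w : ℂ) : ‖1 + w‖ ≤ 1 + w.re + ‖w‖ ^ 2 / 2 := by
  have h1 : ‖1 + w‖ ^ 2 = 1 + 2 * w.re + ‖w‖ ^ 2 := by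
    rw [← Complex.normSq_eq_norm_sq, ← Complex.normSq_eq_norm_sq]
    simp [Complex.normSq_apply]
    ring
  nlinarith [sq_nonneg (‖1 + w‖ - 1)]

/-- If `F (z + h) = 1 + Q h + o(‖h‖²)` with `Re Q` negative definite, then `|F|` is bounded by a
Gaussian near `z`. -/
lemma norm_le_exp_of_expansion {F Q : ℝ × ℝ → ℂ} {z : ℝ × ℝ} {c C : ℝ} (hc : 0 < c)
    (hQ : ∀ h, (Q h).re ≤ -c * ‖h‖ ^ 2) (hQC : ∀ h, ‖Q h‖ ≤ C * ‖h‖ ^ 2)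
    (hF : (fun h => F (z + h) - (1 + Q h)) =o[𝓝 0] fun h => ‖h‖ ^ 2) :
    ∀ᶠ h in 𝓝 (0 : ℝ × ℝ), ‖F (z + h)‖ ≤ Real.exp (-(c / 2) * ‖h‖ ^ 2) := by
  have hlim : ∀ᶠ h in 𝓝 (0 : ℝ × ℝ), C ^ 2 * ‖h‖ ^ 2 < c / 2 := by
    have : Tendsto (fun h : ℝ × ℝ => C ^ 2 * ‖h‖ ^ 2) (𝓝 0) (𝓝 0) := by
      have h1 : Continuous fun h : ℝ × ℝ => C ^ 2 * ‖h‖ ^ 2 := by fun_prop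
      simpa using h1.tendsto 0
    exact this.eventually_lt_const (half_pos hc)
  filter_upwards [hlim, hF.def (show 0 < c / 4 by positivity)] with h h1 h2
  have h3 : ‖F (z + h)‖ ≤ ‖F (z + h) - (1 + Q h)‖ + ‖1 + Q h‖ := by
    simpa using norm_add_le (F (z + h) - (1 + Q h)) (1 + Q h)
  have h4 := norm_one_add_le (Q h)
  have h5 : ‖Q h‖ ^ 2 ≤ (C * ‖h‖ ^ 2) ^ 2 := pow_le_pow_left₀ (norm_nonneg _) (hQC h) 2
  have h6 := hQ h
  rw [Real.norm_of_nonneg (by positivity)] at h2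
  have h7 := Real.add_one_le_exp (-(c / 2) * ‖h‖ ^ 2)
  have h8 : (C * ‖h‖ ^ 2) ^ 2 ≤ c / 2 * ‖h‖ ^ 2 := by
    have := mul_le_mul_of_nonneg_right h1.le (sq_nonneg ‖h‖)
    nlinarith
  linarith

/-- **Laplace's method** at one nondegenerate maximum, with a complex Hessian: after rescaling by
`√k` the powers converge, dominated by a Gaussian. -/
lemma tendsto_integral_closedBall_pow {F Q : ℝ × ℝ → ℂ} {z : ℝ × ℝ} {c δ : ℝ} (hc : 0 < c)
    (hδ : 0 < δ) (hFc : Continuous F) (hQh : ∀ (r : ℝ) h, Q (r • h) = (r : ℂ) ^ 2 * Q h)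
    (hF : (fun h => F (z + h) - (1 + Q h)) =o[𝓝 0] fun h => ‖h‖ ^ 2)
    (hb : ∀ h, ‖h‖ ≤ δ → ‖F (z + h)‖ ≤ Real.exp (-c * ‖h‖ ^ 2)) :
    Tendsto (fun k : ℕ => (k : ℂ) * ∫ x in Metric.closedBall z δ, F x ^ k) atTop
      (𝓝 (∫ h, Complex.exp (Q h))) := by
  set G : ℕ → ℝ × ℝ → ℂ := fun k =>
    (Metric.closedBall (0 : ℝ × ℝ) δ).indicator fun h => F (z + h) ^ k with hG
  have hresc : ∀ k : ℕ, 0 < k → (k : ℂ) * ∫ x in Metric.closedBall z δ, F x ^ k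
      = ∫ h, G k ((√k)⁻¹ • h) := by
    intro k hk
    rw [Measure.integral_comp_smul volume (G k) ((√k)⁻¹), hG]
    simp only [Module.finrank_prod, Module.finrank_self]
    rw [integral_indicator Metric.isClosed_closedBall.measurableSet, inv_pow, inv_inv,
      Real.sq_sqrt (Nat.cast_nonneg k), abs_of_nonneg (Nat.cast_nonneg k), Complex.real_smul]
    congr 1
    rw [← integral_indicator Metric.isClosed_closedBall.measurableSet,
      ← integral_indicator Metric.isClosed_closedBall.measurableSet,
      ← integral_add_left_eq_self (μ := volume) _ z]
    congr 1
    ext h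
    simp [Set.indicator]
  have hev : ∀ᶠ k : ℕ in atTop, ∫ h, G k ((√k)⁻¹ • h)
      = (k : ℂ) * ∫ x in Metric.closedBall z δ, F x ^ k := by
    filter_upwards [eventually_gt_atTop 0] with k hk
    exact (hresc k hk).symm
  refine Tendsto.congr' hev ?_
  have hnorm : ∀ (k : ℕ) (h : ℝ × ℝ), 0 < k → (k : ℝ) * ‖(√k)⁻¹ • h‖ ^ 2 = ‖h‖ ^ 2 := by
    intro k h hk
    rw [norm_smul, norm_inv, Real.norm_of_nonneg (Real.sqrt_nonneg _), mul_pow, inv_pow,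
      Real.sq_sqrt (Nat.cast_nonneg k), mul_inv_cancel_left₀]
    exact_mod_cast hk.ne'
  refine tendsto_integral_filter_of_dominated_convergence
    (fun h => Real.exp (-c * ‖h‖ ^ 2)) ?_ ?_ (integrable_exp_neg_sq_norm hc) ?_
  · refine Eventually.of_forall fun k => Measurable.aestronglyMeasurable ?_
    refine Measurable.comp (g := G k) ?_ (by fun_prop)
    exact Measurable.indicator (by fun_prop) Metric.isClosed_closedBall.measurableSet
  · filter_upwards [eventually_gt_atTop 0] with k hk
    refine Eventually.of_forall fun h => ?_
    by_cases hm : (√k)⁻¹ • h ∈ Metric.closedBall (0 : ℝ × ℝ) δ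
    · rw [hG]
      simp only [Set.indicator_of_mem hm, norm_pow]
      refine (pow_le_pow_left₀ (norm_nonneg _) (hb _ (by simpa using hm)) k).trans_eq ?_
      rw [← Real.exp_nat_mul, ← hnorm k h hk]
      congr 1
      ring
    · rw [hG]
      simp only [Set.indicator_of_notMem hm, norm_zero]
      positivity
  · refine Eventually.of_forall fun h => ?_
    have hsq : Tendsto (fun k : ℕ => (√(k : ℝ))⁻¹) atTop (𝓝 0) :=
      tendsto_inv_atTop_zero.comp (Real.tendsto_sqrt_atTop.comp tendsto_natCast_atTop_atTop)
    have hto : Tendsto (fun k : ℕ => (√(k : ℝ))⁻¹ • h) atTop (𝓝 0) := by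
      simpa using hsq.smul_const h
    have hpow : Tendsto (fun k : ℕ => (1 + (F (z + (√(k : ℝ))⁻¹ • h) - 1)) ^ k) atTop
        (𝓝 (Complex.exp (Q h))) := by
      apply Complex.tendsto_one_add_pow_exp_of_tendsto
      have hO : (fun k : ℕ => (k : ℂ) * (F (z + (√(k : ℝ))⁻¹ • h) - (1 + Q ((√(k : ℝ))⁻¹ • h))))
          =o[atTop] fun _ => (1 : ℝ) := by
        have h0 : (fun k : ℕ => (k : ℂ)) =O[atTop] fun k : ℕ => (k : ℝ) :=
          Asymptotics.IsBigO.of_bound 1 (by simp)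
        refine (h0.mul_isLittleO (hF.comp_tendsto hto)).trans_isBigO
          (Asymptotics.IsBigO.of_bound (‖h‖ ^ 2) ?_)
        filter_upwards [eventually_gt_atTop 0] with k hk
        rw [Function.comp_apply, hnorm k h hk]
        simp
      have h2 := (Asymptotics.isLittleO_one_iff ℝ).mp hO
      have h3 := h2.add_const (Q h)
      rw [zero_add] at h3
      refine h3.congr' ?_
      filter_upwards [eventually_gt_atTop 0] with k hk
      have hk' : (k : ℂ) ≠ 0 := by exact_mod_cast hk.ne'
      have hsk : ((√(k : ℝ) : ℝ) : ℂ) ^ 2 = k := by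
        rw [← Complex.ofReal_pow, Real.sq_sqrt (Nat.cast_nonneg k), Complex.ofReal_natCast]
      rw [hQh, Complex.ofReal_inv, inv_pow, hsk]
      field_simp
      ring
    refine hpow.congr' ?_
    have hball : ∀ᶠ k : ℕ in atTop, (√(k : ℝ))⁻¹ • h ∈ Metric.closedBall (0 : ℝ × ℝ) δ :=
      hto.eventually_mem (Metric.closedBall_mem_nhds 0 hδ)
    filter_upwards [hball] with k hk
    rw [hG]
    simp only [Set.indicator_of_mem hk]
    ring

/-- **Laplace's method** for the powers of a function `F` on a compact set, whose modulus attains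
its maximum `1` at finitely many interior points `z`, near which
`F (z + h) = ω z (1 + Q z h + o(‖h‖²))` with `Re (Q z)` negative definite. -/
lemma tendsto_integral_pow_sub_sum {F : ℝ × ℝ → ℂ} {K : Set (ℝ × ℝ)} {Z : Finset (ℝ × ℝ)}
    {ω : ℝ × ℝ → ℂ} {Q : ℝ × ℝ → ℝ × ℝ → ℂ} (hFc : Continuous F) (hK : IsCompact K)
    (hZ : ∀ z ∈ Z, z ∈ interior K) (hlt : ∀ z ∈ K, z ∉ Z → ‖F z‖ < 1)
    (hω : ∀ z ∈ Z, ‖ω z‖ = 1)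
    (hQh : ∀ z ∈ Z, ∀ (r : ℝ) h, Q z (r • h) = (r : ℂ) ^ 2 * Q z h)
    (hQ : ∀ z ∈ Z, ∃ c > 0, ∀ h, (Q z h).re ≤ -c * ‖h‖ ^ 2)
    (hQC : ∀ z ∈ Z, ∃ C, ∀ h, ‖Q z h‖ ≤ C * ‖h‖ ^ 2)
    (hF : ∀ z ∈ Z, (fun h => F (z + h) / ω z - (1 + Q z h)) =o[𝓝 0] fun h => ‖h‖ ^ 2) :
    Tendsto (fun k : ℕ => (k : ℂ) * (∫ x in K, F x ^ k)
      - ∑ z ∈ Z, ω z ^ k * ∫ h, Complex.exp (Q z h)) atTop (𝓝 0) := by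
  choose! c hc hQc using hQ
  choose! C hQC using hQC
  -- one radius that serves all points of `Z`
  have hδ : ∃ δ > 0, (∀ z ∈ Z, Metric.closedBall z δ ⊆ K) ∧
      (∀ z ∈ Z, ∀ h, ‖h‖ ≤ δ → ‖F (z + h) / ω z‖ ≤ Real.exp (-(c z / 2) * ‖h‖ ^ 2)) ∧
      (Z : Set (ℝ × ℝ)).Pairwise
        (Function.onFun Disjoint fun z => Metric.closedBall z δ) := by
    have h1 : ∀ᶠ δ in 𝓝[>] (0 : ℝ), ∀ z ∈ Z, Metric.closedBall z δ ⊆ K := by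
      rw [Filter.eventually_all_finset]
      intro z hz
      have : ∀ᶠ δ in 𝓝 (0 : ℝ), Metric.closedBall z δ ⊆ K :=
        eventually_closedBall_subset (mem_interior_iff_mem_nhds.mp (hZ z hz))
      exact this.filter_mono nhdsWithin_le_nhds
    have h2 : ∀ᶠ δ in 𝓝[>] (0 : ℝ), ∀ z ∈ Z, ∀ h : ℝ × ℝ, ‖h‖ ≤ δ →
        ‖F (z + h) / ω z‖ ≤ Real.exp (-(c z / 2) * ‖h‖ ^ 2) := by
      rw [Filter.eventually_all_finset]
      intro z hz
      have h3 := norm_le_exp_of_expansion (F := fun x => F x / ω z) (hc z hz) (hQc z hz)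
        (hQC z hz) (hF z hz)
      have : ∀ᶠ δ in 𝓝 (0 : ℝ), Metric.closedBall (0 : ℝ × ℝ) δ ⊆ _ :=
        eventually_closedBall_subset h3
      filter_upwards [this.filter_mono nhdsWithin_le_nhds] with δ hδ h hh
      exact hδ (by simpa using hh)
    have h3 : ∀ᶠ δ in 𝓝[>] (0 : ℝ), ∀ z ∈ Z, ∀ w ∈ Z, z ≠ w →
        Disjoint (Metric.closedBall z δ) (Metric.closedBall w δ) := by
      rw [Filter.eventually_all_finset]
      intro z _
      rw [Filter.eventually_all_finset]
      intro w _
      by_cases hzw : z = w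
      · simp [hzw]
      · have : ∀ᶠ δ in 𝓝 (0 : ℝ), δ < dist z w / 2 :=
          eventually_lt_nhds (half_pos (dist_pos.mpr hzw))
        filter_upwards [this.filter_mono nhdsWithin_le_nhds] with δ hδ _
        exact Metric.closedBall_disjoint_closedBall (by linarith)
    obtain ⟨δ, ⟨⟨h1, h2⟩, h3⟩, h4⟩ := ((h1.and h2).and h3 |>.and self_mem_nhdsWithin).exists
    exact ⟨δ, h4, h1, h2, fun z hz w hw hne => h3 z hz w hw hne⟩
  obtain ⟨δ, hδ0, hsub, hexp, hdisj⟩ := hδ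
  set U : Set (ℝ × ℝ) := ⋃ z ∈ Z, Metric.closedBall z δ with hU
  have hUm : MeasurableSet U :=
    Finset.measurableSet_biUnion Z fun z _ => Metric.isClosed_closedBall.measurableSet
  have hint : ∀ (k : ℕ) (s : Set (ℝ × ℝ)), s ⊆ K → IntegrableOn (fun x => F x ^ k) s :=
    fun k s hs => ((hFc.pow k).continuousOn.integrableOn_compact hK).mono_set hs
  have hUK : U ⊆ K := Set.iUnion₂_subset hsub
  have hsplit : ∀ k : ℕ, ∫ x in K, F x ^ k
      = ∑ z ∈ Z, (∫ x in Metric.closedBall z δ, F x ^ k) + ∫ x in K \ U, F x ^ k := by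
    intro k
    rw [← integral_biUnion_finset Z (fun z _ => Metric.isClosed_closedBall.measurableSet) hdisj
      (fun z hz => hint k _ (hsub z hz)), ← hU,
      ← setIntegral_union Set.disjoint_sdiff_right (hK.measurableSet.diff hUm) (hint k _ hUK)
        (hint k _ Set.sdiff_subset), Set.union_sdiff_cancel hUK]
  -- away from `Z` the modulus of `F` is bounded by some `ρ < 1`
  have hfar : Tendsto (fun k : ℕ => (k : ℂ) * ∫ x in K \ U, F x ^ k) atTop (𝓝 0) := by
    have hρ : ∃ ρ, 0 ≤ ρ ∧ ρ < 1 ∧ ∀ x ∈ K \ U, ‖F x‖ ≤ ρ := by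
      set V : Set (ℝ × ℝ) := ⋃ z ∈ Z, Metric.ball z δ
      have hVo : IsOpen V := isOpen_biUnion fun z _ => Metric.isOpen_ball
      have hKV : IsCompact (K \ V) := hK.diff hVo
      have hsubV : K \ U ⊆ K \ V := Set.sdiff_subset_sdiff_right
        (Set.iUnion₂_mono fun z _ => Metric.ball_subset_closedBall)
      rcases (K \ V).eq_empty_or_nonempty with he | hne
      · exact ⟨0, le_rfl, one_pos, fun x hx => absurd (hsubV hx) (by simp [he])⟩
      · obtain ⟨x, hx, hmax⟩ := hKV.exists_isMaxOn hne hFc.norm.continuousOn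
        refine ⟨‖F x‖, norm_nonneg _, hlt x hx.1 fun hxZ => hx.2 ?_, fun y hy => hmax (hsubV hy)⟩
        exact Set.mem_biUnion hxZ (Metric.mem_ball_self hδ0)
    obtain ⟨ρ, hρ0, hρ1, hρ⟩ := hρ
    have hvol : volume (K \ U) < ⊤ :=
      (measure_mono Set.sdiff_subset).trans_lt hK.measure_lt_top
    have hg : Tendsto (fun k : ℕ => (k * ρ ^ k) * (volume (K \ U)).toReal) atTop (𝓝 0) := by
      simpa using (tendsto_self_mul_const_pow_of_lt_one hρ0 hρ1).mul_const
        (volume (K \ U)).toReal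
    refine squeeze_zero_norm (fun k => ?_) hg
    rw [norm_mul, Complex.norm_natCast, mul_assoc]
    gcongr
    exact norm_setIntegral_le_of_norm_le_const hvol fun x hx => by
      rw [norm_pow]; exact pow_le_pow_left₀ (norm_nonneg _) (hρ x hx) k
  have hnear : ∀ z ∈ Z, Tendsto (fun k : ℕ => (k : ℂ) * (∫ x in Metric.closedBall z δ, F x ^ k)
      - ω z ^ k * ∫ h, Complex.exp (Q z h)) atTop (𝓝 0) := by
    intro z hz
    have h1 := tendsto_integral_closedBall_pow (F := fun x => F x / ω z) (Q := Q z)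
      (half_pos (hc z hz)) hδ0 (hFc.div_const _) (hQh z hz) (hF z hz) (hexp z hz)
    have h2 := h1.sub_const (∫ h, Complex.exp (Q z h))
    rw [sub_self] at h2
    rw [tendsto_zero_iff_norm_tendsto_zero] at h2 ⊢
    refine h2.congr fun k => ?_
    have hne : ω z ≠ 0 := norm_pos_iff.mp (by rw [hω z hz]; exact one_pos)
    have h3 : ∫ x in Metric.closedBall z δ, F x ^ k
        = ω z ^ k * ∫ x in Metric.closedBall z δ, (F x / ω z) ^ k := by
      rw [← integral_const_mul]
      congr 1; ext x
      rw [← mul_pow, mul_div_cancel₀ _ hne]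
    rw [h3, mul_left_comm, ← mul_sub, norm_mul, norm_pow, hω z hz, one_pow, one_mul]
  have hall := (tendsto_finsetSum Z hnear).add hfar
  simp only [Finset.sum_const_zero, add_zero] at hall
  refine hall.congr fun k => ?_
  rw [hsplit k, Finset.sum_sub_distrib, mul_add, Finset.mul_sum]
  ring

/-! ### The Gaussian integral at an intersection -/

/-- The quadratic part at an intersection of the kernel `⟨σt(t), γt(s)⟩`, where `m` is the inner
product of the two horizontal velocities. -/
def crossingForm (m : ℂ) (h : ℝ × ℝ) : ℂ :=
  -(((h.1 ^ 2 + h.2 ^ 2) / 4 : ℝ) : ℂ) + m * ((h.1 * h.2 : ℝ) : ℂ)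

lemma crossingForm_smul (m : ℂ) (r : ℝ) (h : ℝ × ℝ) :
    crossingForm m (r • h) = (r : ℂ) ^ 2 * crossingForm m h := by
  simp only [crossingForm, Prod.smul_fst, Prod.smul_snd, smul_eq_mul]
  push_cast
  ring

lemma sq_norm_le_add_sq (h : ℝ × ℝ) : ‖h‖ ^ 2 ≤ h.1 ^ 2 + h.2 ^ 2 := by
  rw [Prod.norm_def, Real.norm_eq_abs, Real.norm_eq_abs]
  rcases max_choice |h.1| |h.2| with e | e <;> rw [e, sq_abs] <;>
    nlinarith [sq_nonneg h.1, sq_nonneg h.2]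

lemma crossingForm_re_le {m : ℂ} (hm : |m.re| < 1 / 2) (h : ℝ × ℝ) :
    (crossingForm m h).re ≤ -(1 / 4 - |m.re| / 2) * ‖h‖ ^ 2 := by
  have h1 : (crossingForm m h).re = -((h.1 ^ 2 + h.2 ^ 2) / 4) + m.re * (h.1 * h.2) := by
    rw [crossingForm, Complex.add_re, Complex.neg_re, Complex.ofReal_re, Complex.re_mul_ofReal]
  have h2 : m.re * (h.1 * h.2) ≤ |m.re| * ((h.1 ^ 2 + h.2 ^ 2) / 2) := by
    refine (le_abs_self _).trans ?_
    rw [abs_mul]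
    gcongr
    rw [abs_le]
    constructor <;> nlinarith [sq_nonneg (h.1 + h.2), sq_nonneg (h.1 - h.2)]
  have h3 := mul_le_mul_of_nonneg_left (sq_norm_le_add_sq h)
    (show 0 ≤ 1 / 4 - |m.re| / 2 by linarith)
  rw [h1]
  linarith

lemma norm_crossingForm_le (m : ℂ) (h : ℝ × ℝ) :
    ‖crossingForm m h‖ ≤ (1 / 2 + ‖m‖) * ‖h‖ ^ 2 := by
  have h1 : |h.1| ≤ ‖h‖ := norm_fst_le h
  have h2 : |h.2| ≤ ‖h‖ := norm_snd_le h
  have h3 : h.1 ^ 2 ≤ ‖h‖ ^ 2 := by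
    rw [← sq_abs]; exact pow_le_pow_left₀ (abs_nonneg _) h1 2
  have h4 : h.2 ^ 2 ≤ ‖h‖ ^ 2 := by
    rw [← sq_abs]; exact pow_le_pow_left₀ (abs_nonneg _) h2 2
  have h5 : |h.1| * |h.2| ≤ ‖h‖ * ‖h‖ := mul_le_mul h1 h2 (abs_nonneg _) (norm_nonneg _)
  have h6 := mul_le_mul_of_nonneg_left h5 (norm_nonneg m)
  refine (norm_add_le _ _).trans ?_
  rw [norm_neg, norm_mul, Complex.norm_real, Complex.norm_real, Real.norm_eq_abs,
    Real.norm_eq_abs, abs_mul, abs_of_nonneg (by positivity)]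
  nlinarith

/-- The Gaussian integral over `ℝ²`; the square root `w` of `1 - 4m²` is the one in the right half
plane. -/
lemma integral_exp_crossingForm {m w : ℂ} (hm : |m.re| < 1 / 2) (hw : 0 < w.re)
    (hwm : w ^ 2 = 1 - 4 * m ^ 2) :
    ∫ h, Complex.exp (crossingForm m h) = 4 * Real.pi / w := by
  have hsq : ∀ x : ℂ, 0 < x.re → (x ^ 2) ^ (1 / 2 : ℂ) = x := by
    intro x hx
    have := Complex.sq_cpow_two_inv hx
    simpa using this
  have hint : Integrable fun h : ℝ × ℝ => Complex.exp (crossingForm m h) := by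
    refine (integrable_exp_neg_sq_norm (c := 1 / 4 - |m.re| / 2) (by linarith)).mono'
      ?_ (Eventually.of_forall fun h => ?_)
    · apply Continuous.aestronglyMeasurable
      unfold crossingForm
      fun_prop
    · rw [Complex.norm_exp]
      exact Real.exp_le_exp.mpr (crossingForm_re_le hm h)
  have hpi : (0 : ℝ) < √Real.pi := Real.sqrt_pos.mpr Real.pi_pos
  have hpi2 : ((√Real.pi : ℝ) : ℂ) ^ 2 = Real.pi := by
    rw [← Complex.ofReal_pow, Real.sq_sqrt Real.pi_pos.le]
  have hw0 : w ≠ 0 := fun h => by simp [h] at hw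
  have hin : ∀ x : ℝ, ∫ y : ℝ, Complex.exp (crossingForm m (x, y))
      = 2 * (√Real.pi : ℝ) * Complex.exp (-(w ^ 2 / 4) * (x : ℂ) ^ 2) := by
    intro x
    have h1 := integral_cexp_quadratic (b := -(1 / 4)) (by norm_num) (m * x) (-(x : ℂ) ^ 2 / 4)
    have h2 : (Real.pi / -(-(1 / 4)) : ℂ) = (2 * (√Real.pi : ℝ)) ^ 2 := by
      rw [mul_pow, hpi2]; ring
    rw [h2, hsq _ (by simpa using hpi)] at h1
    convert! h1 using 3
    · simp only [crossingForm]
      congr 1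
      push_cast
      ring
    · rw [hwm]
      ring
  rw [Measure.volume_eq_prod, integral_prod _ (by rwa [← Measure.volume_eq_prod])]
  simp only [hin]
  have hb : 0 < (w ^ 2 / 4).re := by
    have h1 : (w ^ 2).re = 1 - 4 * (m.re ^ 2 - m.im ^ 2) := by
      rw [hwm]; simp [pow_two]
    have h2 : m.re ^ 2 < 1 / 4 := by
      rw [← sq_abs]; nlinarith [abs_nonneg m.re]
    have h3 : (w ^ 2 / 4).re = (w ^ 2).re / 4 := by
      simp
    rw [h3, h1]
    nlinarith [sq_nonneg m.im]
  rw [integral_const_mul, integral_gaussian_complex hb]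
  have h4 : (Real.pi / (w ^ 2 / 4) : ℂ) = (2 * (√Real.pi : ℝ) / w) ^ 2 := by
    rw [div_pow, mul_pow, hpi2]; field_simp; norm_num
  have h5 : 0 < (2 * ((√Real.pi : ℝ) : ℂ) / w).re := by
    have : (2 * ((√Real.pi : ℝ) : ℂ) / w) = ((2 * √Real.pi : ℝ) : ℂ) * w⁻¹ := by
      push_cast; ring
    rw [this, Complex.re_ofReal_mul, Complex.inv_re]
    have := Complex.normSq_pos.mpr hw0
    positivity
  rw [h4, hsq _ h5]
  field_simp
  rw [hpi2]
  ring

/-- The Gaussian integral at an intersection, in terms of the angle. The root of `1 - 4m²` in the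
right half plane is `√(2 sin θ) e^{i o (π/4 - θ/2)}`, because `θ ∈ (0, π)`. -/
lemma integral_exp_crossingForm_eq {m : ℂ} {θ o : ℝ} (hθ0 : 0 ≤ θ) (hθπ : θ ≤ Real.pi)
    (hsin : 0 < Real.sin θ) (ho : o ^ 2 = 1) (hre : 2 * m.re = Real.cos θ)
    (him : 2 * m.im = -(o * Real.sin θ)) :
    |m.re| < 1 / 2 ∧ 1 / (2 * (Real.pi : ℂ)) * ∫ h, Complex.exp (crossingForm m h)
      = (√2 : ℝ) * (Complex.exp (Complex.I * ((o * (θ / 2 - Real.pi / 4) : ℝ) : ℂ))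
        / ((√(Real.sin θ) : ℝ) : ℂ)) := by
  have hm : |m.re| < 1 / 2 := by
    have h1 := Real.sin_sq_add_cos_sq θ
    have h2 : (2 * m.re) ^ 2 < 1 := by rw [hre]; nlinarith
    rw [abs_lt]
    constructor <;> nlinarith
  refine ⟨hm, ?_⟩
  have ho' : o = 1 ∨ o = -1 := sq_eq_sq_iff_eq_or_eq_neg.mp (by rw [ho, one_pow])
  set α : ℝ := o * (Real.pi / 4 - θ / 2) with hα
  set r : ℝ := √(2 * Real.sin θ) with hr
  have hr0 : 0 < r := Real.sqrt_pos.mpr (by positivity)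
  have hr2 : r ^ 2 = 2 * Real.sin θ := Real.sq_sqrt (by positivity)
  set w : ℂ := (r : ℂ) * Complex.exp (α * Complex.I) with hw
  have hpi := Real.pi_pos
  have hwre : 0 < w.re := by
    rw [hw, Complex.re_ofReal_mul, Complex.exp_ofReal_mul_I_re]
    refine mul_pos hr0 (Real.cos_pos_of_mem_Ioo ?_)
    rcases ho' with e | e <;> rw [hα, e] <;> constructor <;> linarith
  have hcs : Real.cos (2 * α) = Real.sin θ ∧ Real.sin (2 * α) = o * Real.cos θ := by
    have e0 : 2 * α = o * (Real.pi / 2 - θ) := by rw [hα]; ring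
    rcases ho' with e | e <;> rw [e0, e]
    · rw [one_mul, Real.cos_pi_div_two_sub, Real.sin_pi_div_two_sub, one_mul]
      exact ⟨rfl, rfl⟩
    · rw [neg_one_mul, Real.cos_neg, Real.sin_neg, Real.cos_pi_div_two_sub,
        Real.sin_pi_div_two_sub, neg_one_mul]
      exact ⟨rfl, rfl⟩
  have hwm : w ^ 2 = 1 - 4 * m ^ 2 := by
    have e1 : w ^ 2 = ((r ^ 2 : ℝ) : ℂ) * Complex.exp ((2 * α : ℝ) * Complex.I) := by
      rw [hw, mul_pow, ← Complex.exp_nat_mul]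
      push_cast
      ring_nf
    have hs := Real.sin_sq_add_cos_sq θ
    rw [e1, hr2]
    apply Complex.ext
    · rw [Complex.re_ofReal_mul, Complex.exp_ofReal_mul_I_re, hcs.1]
      have : (1 - 4 * m ^ 2).re = 1 - ((2 * m.re) ^ 2 - (2 * m.im) ^ 2) := by
        simp [pow_two]; ring
      rw [this, hre, him]
      linear_combination hs + (-Real.sin θ ^ 2) * ho
    · rw [Complex.im_ofReal_mul, Complex.exp_ofReal_mul_I_im, hcs.2]
      have : (1 - 4 * m ^ 2).im = - (2 * (2 * m.re) * (2 * m.im)) := by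
        simp [pow_two]; ring
      rw [this, hre, him]
      ring
  rw [integral_exp_crossingForm hm hwre hwm]
  have hexp : Complex.exp (Complex.I * ((o * (θ / 2 - Real.pi / 4) : ℝ) : ℂ))
      = (Complex.exp (α * Complex.I))⁻¹ := by
    rw [← Complex.exp_neg]
    congr 1
    rw [hα]
    push_cast
    ring
  have hrs : (r : ℂ) = (√2 : ℝ) * (√(Real.sin θ) : ℝ) := by
    rw [hr, Real.sqrt_mul (by norm_num)]; push_cast; rfl
  have h22 : ((√2 : ℝ) : ℂ) ^ 2 = 2 := by
    rw [← Complex.ofReal_pow, Real.sq_sqrt (by norm_num)]; norm_num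
  have n1 : ((√2 : ℝ) : ℂ) ≠ 0 := by
    exact_mod_cast (Real.sqrt_pos.mpr (show (0 : ℝ) < 2 by norm_num)).ne'
  have n2 : ((√(Real.sin θ) : ℝ) : ℂ) ≠ 0 := by exact_mod_cast (Real.sqrt_pos.mpr hsin).ne'
  have n3 : (Real.pi : ℂ) ≠ 0 := by exact_mod_cast Real.pi_ne_zero
  have n4 := Complex.exp_ne_zero (α * Complex.I)
  rw [hexp, hw, hrs]
  field_simp
  rw [h22]
  norm_num

/-! ### Horizontal vectors and the Hopf map -/

/-- The derivative of the Hopf map at `p`. -/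
def hopfDeriv (p a : C2) : R3 :=
  !₂[2 * (a 0 * conj (p 1) + p 0 * conj (a 1)).re, 2 * (a 0 * conj (p 1) + p 0 * conj (a 1)).im,
    2 * (conj (p 1) * a 1).re - 2 * (conj (p 0) * a 0).re]

lemma hasDerivAt_hopf {γt : ℝ → C2} {a : C2} {s : ℝ} (h : HasDerivAt γt a s) :
    HasDerivAt (fun t => hopf (γt t)) (hopfDeriv (γt s) a) s := by
  have hc : ∀ i : Fin 2, HasDerivAt (fun t => γt t i) (a i) s := fun i =>
    ((EuclideanSpace.proj (𝕜 := ℂ) i).restrictScalars ℝ).hasFDerivAt.comp_hasDerivAt s h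
  have hcj : ∀ i : Fin 2, HasDerivAt (fun t => conj (γt t i)) (conj (a i)) s := fun i => (hc i).star
  have hprod := (hc 0).mul (hcj 1)
  have hre := Complex.reCLM.hasFDerivAt.comp_hasDerivAt s hprod
  have him := Complex.imCLM.hasFDerivAt.comp_hasDerivAt s hprod
  have hn : ∀ i : Fin 2, HasDerivAt (fun t => ‖γt t i‖ ^ 2) (2 * (conj (γt s i) * a i).re) s := by
    intro i
    convert! (hc i).norm_sq using 1
    simp [Complex.inner]
    ring
  rw [hasDerivAt_iff_hasFDerivAt, ← hasFDerivWithinAt_univ, hasFDerivWithinAt_euclidean]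
  intro i
  rw [hasFDerivWithinAt_univ]
  suffices H : HasDerivAt (fun t => hopf (γt t) i) (hopfDeriv (γt s) a i) s by
    convert! H.hasFDerivAt using 1
  fin_cases i
  · exact hre.const_mul 2
  · exact him.const_mul 2
  · exact (hn 1).sub (hn 0)

lemma inner_C2 (a b : C2) : (inner ℂ a b : ℂ) = conj (a 0) * b 0 + conj (a 1) * b 1 := by
  simp [PiLp.inner_apply, Fin.sum_univ_two]
  ring

lemma sq_norm_C2 (p : C2) :
    ‖p‖ ^ 2 = (p 0).re ^ 2 + (p 0).im ^ 2 + ((p 1).re ^ 2 + (p 1).im ^ 2) := by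
  rw [EuclideanSpace.norm_sq_eq, Fin.sum_univ_two, ← Complex.normSq_eq_norm_sq,
    ← Complex.normSq_eq_norm_sq, Complex.normSq_apply, Complex.normSq_apply]
  ring

/-- The complex line of horizontal vectors at `p` is spanned by `(conj p₁, -conj p₀)`. -/
lemma exists_eq_smul_of_horizontal {p a : C2} (hp : ‖p‖ = 1) (ha : inner ℂ p a = 0) :
    ∃ l : ℂ, a 0 = l * conj (p 1) ∧ a 1 = -l * conj (p 0) := by
  rw [inner_C2] at ha
  have hp2 : conj (p 0) * p 0 + conj (p 1) * p 1 = 1 := by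
    rw [← inner_C2, inner_self_eq_norm_sq_to_K, hp]; simp
  refine ⟨a 0 * p 1 - a 1 * p 0, ?_, ?_⟩
  · linear_combination (-a 0) * hp2 + p 0 * ha
  · linear_combination (-a 1) * hp2 + p 1 * ha

lemma inner_of_eq_smul {p a b : C2} {l m : ℂ} (hp : ‖p‖ = 1)
    (ha : a 0 = l * conj (p 1) ∧ a 1 = -l * conj (p 0))
    (hb : b 0 = m * conj (p 1) ∧ b 1 = -m * conj (p 0)) :
    (inner ℂ a b : ℂ) = conj l * m := by
  have hp2 : conj (p 0) * p 0 + conj (p 1) * p 1 = 1 := by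
    rw [← inner_C2, inner_self_eq_norm_sq_to_K, hp]; simp
  rw [inner_C2, ha.1, ha.2, hb.1, hb.2]
  simp only [map_mul, map_neg, Complex.conj_conj]
  linear_combination conj l * m * hp2

/-- On horizontal vectors the Hopf map is conformal with factor `2`. -/
lemma inner_hopfDeriv {p a b : C2} (hp : ‖p‖ = 1) (ha : inner ℂ p a = 0) (hb : inner ℂ p b = 0) :
    inner ℝ (hopfDeriv p a) (hopfDeriv p b) = 4 * (inner ℂ a b : ℂ).re := by
  obtain ⟨l, hl⟩ := exists_eq_smul_of_horizontal hp ha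
  obtain ⟨m, hm⟩ := exists_eq_smul_of_horizontal hp hb
  have hN := sq_norm_C2 p
  rw [hp, one_pow] at hN
  rw [inner_of_eq_smul hp hl hm]
  have : inner ℝ (hopfDeriv p a) (hopfDeriv p b) = 4 * (conj l * m).re *
      ((p 0).re ^ 2 + (p 0).im ^ 2 + ((p 1).re ^ 2 + (p 1).im ^ 2)) ^ 2 := by
    simp only [hopfDeriv, PiLp.inner_apply, Fin.sum_univ_three, hl.1, hl.2, hm.1, hm.2]
    simp
    ring
  rw [this, ← hN]
  ring

/-- On horizontal vectors the Hopf map is compatible with the orientations: the complex one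
upstairs, and that by the outer normal downstairs. -/
lemma det_hopfDeriv {p a b : C2} (hp : ‖p‖ = 1) (ha : inner ℂ p a = 0) (hb : inner ℂ p b = 0) :
    Matrix.det !![hopf p 0, hopf p 1, hopf p 2;
      hopfDeriv p a 0, hopfDeriv p a 1, hopfDeriv p a 2;
      hopfDeriv p b 0, hopfDeriv p b 1, hopfDeriv p b 2] = 4 * (inner ℂ a b : ℂ).im := by
  obtain ⟨l, hl⟩ := exists_eq_smul_of_horizontal hp ha
  obtain ⟨m, hm⟩ := exists_eq_smul_of_horizontal hp hb
  have hN := sq_norm_C2 p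
  rw [hp, one_pow] at hN
  rw [inner_of_eq_smul hp hl hm, Matrix.det_fin_three]
  have hn : ∀ i : Fin 2, ‖p i‖ ^ 2 = (p i).re ^ 2 + (p i).im ^ 2 := fun i => by
    rw [← Complex.normSq_eq_norm_sq, Complex.normSq_apply]; ring
  trans 4 * (conj l * m).im *
      ((p 0).re ^ 2 + (p 0).im ^ 2 + ((p 1).re ^ 2 + (p 1).im ^ 2)) ^ 3
  · simp [hopfDeriv, hopf, hl.1, hl.2, hm.1, hm.2, hn]
    ring
  · rw [← hN]
    ring

lemma norm_inner_of_horizontal {p a b : C2} (hp : ‖p‖ = 1) (ha : inner ℂ p a = 0)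
    (hb : inner ℂ p b = 0) : ‖(inner ℂ a b : ℂ)‖ = ‖a‖ * ‖b‖ := by
  obtain ⟨l, hl⟩ := exists_eq_smul_of_horizontal hp ha
  obtain ⟨m, hm⟩ := exists_eq_smul_of_horizontal hp hb
  have key : ∀ {a : C2} {l : ℂ}, a 0 = l * conj (p 1) ∧ a 1 = -l * conj (p 0) → ‖a‖ = ‖l‖ := by
    intro a l hl
    have h := inner_of_eq_smul hp hl hl
    rw [inner_self_eq_norm_sq_to_K, mul_comm, Complex.mul_conj, Complex.normSq_eq_norm_sq] at h
    have h' : ‖a‖ ^ 2 = ‖l‖ ^ 2 := Complex.ofReal_injective (by simpa using h)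
    exact (sq_eq_sq₀ (norm_nonneg _) (norm_nonneg _)).mp h'
  rw [inner_of_eq_smul hp hl hm, key hl, key hm, norm_mul, Complex.norm_conj]

lemma hopf_smul {ω : ℂ} (hω : ‖ω‖ = 1) (q : C2) : hopf (ω • q) = hopf q := by
  have h1 : ω * conj ω = 1 := by rw [Complex.mul_conj, Complex.normSq_eq_norm_sq, hω]; simp
  have h2 : (ω * q 0) * conj (ω * q 1) = q 0 * conj (q 1) := by
    rw [map_mul]; linear_combination (q 0 * conj (q 1)) * h1
  simp only [hopf, PiLp.smul_apply, smul_eq_mul, h2, norm_mul, hω, one_mul]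

lemma two_mul_sq_norm_inner (p q : C2) :
    2 * ‖(inner ℂ q p : ℂ)‖ ^ 2 = ‖p‖ ^ 2 * ‖q‖ ^ 2 + inner ℝ (hopf p) (hopf q) := by
  have hn : ∀ z : ℂ, ‖z‖ ^ 2 = z.re ^ 2 + z.im ^ 2 := fun z => by
    rw [← Complex.normSq_eq_norm_sq, Complex.normSq_apply]; ring
  rw [inner_C2, sq_norm_C2, sq_norm_C2, hn]
  simp only [hopf, PiLp.inner_apply, Fin.sum_univ_three]
  simp [hn]
  ring

/-- Unit vectors with the same image under the Hopf map differ by the phase `lineRatio p q`. -/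
lemma eq_lineRatio_smul {p q : C2} (hp : ‖p‖ = 1) (hq : ‖q‖ = 1) (h : hopf p = hopf q)
    (hn : ‖hopf p‖ = 1) : p = lineRatio p q • q ∧ ‖lineRatio p q‖ = 1 := by
  have hqq : (inner ℂ q q : ℂ) = 1 := by rw [inner_self_eq_norm_sq_to_K, hq]; simp
  have h1 : ‖(inner ℂ q p : ℂ)‖ = 1 := by
    have h2 := two_mul_sq_norm_inner p q
    rw [← h, real_inner_self_eq_norm_sq, hn, hp, hq] at h2
    have h3 : ‖(inner ℂ q p : ℂ)‖ ^ 2 = 1 ^ 2 := by linarith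
    exact (sq_eq_sq₀ (norm_nonneg _) zero_le_one).mp h3
  have hq0 : q ≠ 0 := norm_pos_iff.mp (by rw [hq]; exact one_pos)
  have hp0 : p ≠ 0 := norm_pos_iff.mp (by rw [hp]; exact one_pos)
  obtain ⟨r, -, hr⟩ := (norm_inner_eq_norm_iff (𝕜 := ℂ) hq0 hp0).mp (by rw [h1, hp, hq, one_mul])
  have hl : lineRatio p q = inner ℂ q p := by rw [lineRatio, hqq, div_one]
  refine ⟨?_, by rw [hl, h1]⟩
  rw [hl]
  conv_lhs => rw [hr]
  conv_rhs => rw [hr]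
  rw [inner_smul_right, hqq, mul_one]

lemma norm_inner_lt_one {p q : C2} (hp : ‖p‖ = 1) (hq : ‖q‖ = 1) (h : hopf p ≠ hopf q) :
    ‖(inner ℂ q p : ℂ)‖ < 1 := by
  have hle : ‖(inner ℂ q p : ℂ)‖ ≤ 1 := by simpa [hp, hq] using norm_inner_le_norm (𝕜 := ℂ) q p
  refine lt_of_le_of_ne hle fun h1 => h ?_
  have hq0 : q ≠ 0 := norm_pos_iff.mp (by rw [hq]; exact one_pos)
  have hp0 : p ≠ 0 := norm_pos_iff.mp (by rw [hp]; exact one_pos)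
  obtain ⟨r, -, hr⟩ := (norm_inner_eq_norm_iff (𝕜 := ℂ) hq0 hp0).mp (by rw [h1, hp, hq, one_mul])
  have hr1 : ‖r‖ = 1 := by
    have := congrArg norm hr
    rwa [norm_smul, hq, hp, mul_one, eq_comm] at this
  rw [hr, hopf_smul hr1]

/-! ### Parallel lifts and the kernel near an intersection -/

variable {γ σ : ℝ → R3} {γt σt τ : ℝ → C2} {T S : ℝ}

lemma isLittleO_inner {α E : Type*} [NormedAddCommGroup E] [InnerProductSpace ℂ E]
    {l : Filter α} {u v : α → E} {f g : α → ℝ} (hu : u =o[l] f) (hv : v =O[l] g) :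
    (fun x => (inner ℂ (u x) (v x) : ℂ)) =o[l] fun x => f x * g x := by
  have h1 : (fun x => (inner ℂ (u x) (v x) : ℂ)) =O[l] fun x => ‖u x‖ * ‖v x‖ :=
    IsBigO.of_bound 1 (Eventually.of_forall fun x => by
      rw [one_mul, Real.norm_of_nonneg (by positivity)]
      exact norm_inner_le_norm _ _)
  exact h1.trans_isLittleO (hu.norm_left.mul_isBigO hv.norm_left)

lemma isLittleO_sq_of_deriv {g g' : ℝ → ℂ} (h0 : g 0 = 0) (hg : ∀ x, HasDerivAt g (g' x) x)
    (hg' : g' =o[𝓝 0] fun x : ℝ => x) : g =o[𝓝 0] fun x : ℝ => x ^ 2 := by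
  rw [isLittleO_iff]
  intro c hc
  obtain ⟨δ, hδ, hb⟩ := Metric.eventually_nhds_iff_ball.mp (hg'.def hc)
  filter_upwards [Metric.ball_mem_nhds (0 : ℝ) hδ] with x hx
  have hsub : Metric.closedBall (0 : ℝ) |x| ⊆ Metric.ball 0 δ :=
    Metric.closedBall_subset_ball (by simpa using hx)
  have h := (convex_closedBall (0 : ℝ) |x|).norm_image_sub_le_of_norm_hasDerivWithin_le
    (f := g) (f' := g') (C := c * |x|) (fun y _ => (hg y).hasDerivWithinAt)
    (fun y hy => (hb y (hsub hy)).trans (by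
      have : |y| ≤ |x| := by simpa using hy
      rw [Real.norm_eq_abs]
      gcongr))
    (x := 0) (y := x) (by simp) (by simp)
  rw [h0, sub_zero, sub_zero] at h
  rw [norm_pow, Real.norm_eq_abs] at *
  linarith

lemma IsParallelLift.hasDerivAt (h : IsParallelLift γ γt) (t : ℝ) :
    HasDerivAt γt (deriv γt t) t :=
  ((h.contDiff.differentiable (by norm_num)) t).hasDerivAt

lemma IsParallelLift.deriv_eq (h : IsParallelLift γ γt) (t : ℝ) :
    deriv γ t = hopfDeriv (γt t) (deriv γt t) := by
  have h1 := hasDerivAt_hopf (h.hasDerivAt t)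
  rw [show (fun t => hopf (γt t)) = γ from funext h.hopf_eq] at h1
  exact h1.deriv

lemma IsArclengthLoop.norm_deriv (h : IsArclengthLoop γ T) (t : ℝ) : ‖deriv γ t‖ = √2 := by
  have := h.unit_speed t
  rwa [kahlerLength, div_eq_one_iff_eq (by positivity)] at this

lemma IsParallelLift.sq_norm_deriv (hγ : IsArclengthLoop γ T) (h : IsParallelLift γ γt) (t : ℝ) :
    ‖deriv γt t‖ ^ 2 = 1 / 2 := by
  have h1 := inner_hopfDeriv (h.mem_sphere t) (h.horizontal t) (h.horizontal t)
  rw [← h.deriv_eq, real_inner_self_eq_norm_sq, hγ.norm_deriv, Real.sq_sqrt (by norm_num),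
    inner_self_eq_norm_sq_to_K] at h1
  have h2 : (((‖deriv γt t‖ : ℝ) : ℂ) ^ 2).re = ‖deriv γt t‖ ^ 2 := by
    rw [← Complex.ofReal_pow, Complex.ofReal_re]
  have h3 : (2 : ℝ) = 4 * ‖deriv γt t‖ ^ 2 := h1.trans (congrArg (4 * ·) h2)
  linarith

/-- Multiplying a parallel lift by a constant phase gives another parallel lift. -/
lemma IsParallelLift.smul (h : IsParallelLift σ σt) {ω : ℂ} (hω : ‖ω‖ = 1) :
    IsParallelLift σ (fun t => ω • σt t) where
  contDiff := h.contDiff.const_smul ω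
  mem_sphere t := by rw [norm_smul, hω, h.mem_sphere, one_mul]
  hopf_eq t := by rw [hopf_smul hω, h.hopf_eq]
  horizontal t := by
    have h1 : HasDerivAt (fun t => ω • σt t) (ω • deriv σt t) t := (h.hasDerivAt t).const_smul ω
    rw [h1.deriv, inner_smul_left, inner_smul_right, h.horizontal]
    simp

/-- Parallel transport is unique up to a constant phase, so the holonomy does not depend on the
starting point. -/
lemma IsParallelLift.add_period (hγ : IsArclengthLoop γ T) (h : IsParallelLift γ γt) (s : ℝ) :
    γt (s + T) = holonomy γt T • γt s ∧ ‖holonomy γt T‖ = 1 := by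
  have hhopf : ∀ s, hopf (γt (s + T)) = hopf (γt s) := fun s => by
    rw [h.hopf_eq, h.hopf_eq, hγ.periodic]
  have hr : ∀ s, γt (s + T) = lineRatio (γt (s + T)) (γt s) • γt s
      ∧ ‖lineRatio (γt (s + T)) (γt s)‖ = 1 := fun s =>
    eq_lineRatio_smul (h.mem_sphere _) (h.mem_sphere _) (hhopf s)
      (by rw [h.hopf_eq]; exact hγ.mem_sphere _)
  have hin : ∀ s, lineRatio (γt (s + T)) (γt s) = inner ℂ (γt s) (γt (s + T)) := fun s => by
    rw [lineRatio, inner_self_eq_norm_sq_to_K, h.mem_sphere]; simp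
  have hder : ∀ s, HasDerivAt (fun s => (inner ℂ (γt s) (γt (s + T)) : ℂ)) 0 s := by
    intro s
    have h1 := (h.hasDerivAt s).inner ℂ ((h.hasDerivAt (s + T)).comp_add_const s T)
    convert! h1 using 1
    have e1 : (inner ℂ (deriv γt s) (γt (s + T)) : ℂ) = 0 := by
      rw [(hr s).1, inner_smul_right, ← inner_conj_symm, h.horizontal]; simp
    have e2 : (inner ℂ (γt s) (deriv γt (s + T)) : ℂ) = 0 := by
      have e3 := h.horizontal (s + T)
      rw [(hr s).1, inner_smul_left] at e3
      refine (mul_eq_zero.mp e3).resolve_left fun h0 => ?_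
      have := (hr s).2
      rw [← Complex.norm_conj, h0] at this
      simp at this
    rw [e1, e2, add_zero]
  have hconst := is_const_of_deriv_eq_zero (fun s => (hder s).differentiableAt)
    (fun s => (hder s).deriv) s 0
  have : holonomy γt T = lineRatio (γt (s + T)) (γt s) := by
    rw [hin, hconst, ← hin 0, zero_add, holonomy]
  rw [this]
  exact hr s

/-- Along a parallel lift `⟨γt(s), γt(s + x)⟩ = 1 - x² / 4 + o(x²)`. Although `γt` is only `C¹`, there
is an expansion to second order, since `γt'(s + x)` is orthogonal to `γt(s + x)`. -/
lemma IsParallelLift.isLittleO_inner_self (hγ : IsArclengthLoop γ T) (h : IsParallelLift γ γt)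
    (s : ℝ) :
    (fun x : ℝ => (inner ℂ (γt s) (γt (s + x)) : ℂ) - (1 - (x : ℂ) ^ 2 / 4))
      =o[𝓝 0] fun x : ℝ => x ^ 2 := by
  set a := deriv γt s with ha
  have haa : (inner ℂ a a : ℂ) = 1 / 2 := by
    rw [inner_self_eq_norm_sq_to_K]
    have := h.sq_norm_deriv hγ s
    calc ((‖a‖ : ℂ)) ^ 2 = ((‖a‖ ^ 2 : ℝ) : ℂ) := by push_cast; rfl
      _ = 1 / 2 := by rw [this]; push_cast; rfl
  have hA : (fun x : ℝ => γt (s + x) - γt s - x • a) =o[𝓝 0] fun x : ℝ => x :=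
    (hasDerivAt_iff_isLittleO_nhds_zero.mp (h.hasDerivAt s))
  have hvc : Continuous fun x : ℝ => deriv γt (s + x) :=
    (h.contDiff.continuous_deriv le_rfl).comp (by fun_prop)
  have hv : (fun x : ℝ => deriv γt (s + x)) =O[𝓝 0] fun _ => (1 : ℝ) :=
    (hvc.tendsto 0).isBigO_one ℝ
  have hva : (fun x : ℝ => deriv γt (s + x) - a) =o[𝓝 0] fun _ => (1 : ℝ) := by
    rw [isLittleO_one_iff]
    simpa [ha] using (hvc.tendsto 0).sub_const a
  have hxa : (fun x : ℝ => x • a) =O[𝓝 0] fun x : ℝ => x :=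
    IsBigO.of_bound ‖a‖ (Eventually.of_forall fun x => by rw [norm_smul, mul_comm])
  refine isLittleO_sq_of_deriv
    (g' := fun x => (inner ℂ (γt s) (deriv γt (s + x)) : ℂ) + (x : ℂ) / 2) ?_ ?_ ?_
  · rw [add_zero, inner_self_eq_norm_sq_to_K, h.mem_sphere]
    simp
  · intro x
    have h1 := (hasDerivAt_const x (γt s)).inner ℂ ((h.hasDerivAt (s + x)).comp_const_add s x)
    have h2 : HasDerivAt (fun x : ℝ => (1 - (x : ℂ) ^ 2 / 4)) (-((x : ℂ) / 2)) x := by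
      have h3 := (((hasDerivAt_id x).ofReal_comp.pow 2).div_const 4).const_sub 1
      convert! h3 using 1
      simp
      ring
    convert! h1.sub h2 using 1
    simp
  · have h1 := isLittleO_inner hA hv
    have h2 := (isLittleO_inner hva hxa)
    have h2' : (fun x : ℝ => (inner ℂ (x • a) (deriv γt (s + x) - a) : ℂ)) =o[𝓝 0]
        fun x : ℝ => x := by
      refine IsLittleO.of_norm_left (h2.norm_left.congr (fun x => ?_) fun x => one_mul x)
      exact norm_inner_symm _ _
    simp only [mul_one] at h1
    refine (h1.add h2').neg_left.congr_left fun x => ?_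
    have h3 : (inner ℂ (γt s) (deriv γt (s + x)) : ℂ)
        = - inner ℂ (γt (s + x) - γt s) (deriv γt (s + x)) := by
      rw [inner_sub_left, h.horizontal]; simp
    have h4 : (inner ℂ (x • a) a : ℂ) = x / 2 := by
      rw [← Complex.coe_smul, inner_smul_left, haa]
      simp
      ring
    rw [h3, inner_sub_left (γt (s + x) - γt s), inner_sub_right (x • a), h4]
    ring

/-- The second-order expansion of the kernel at an intersection, for lifts that agree there. -/
lemma isLittleO_inner_sub_crossingForm (hγ : IsArclengthLoop γ T) (hσ : IsArclengthLoop σ S)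
    (h : IsParallelLift γ γt) (h' : IsParallelLift σ τ) {s t : ℝ} (hst : γt s = τ t) :
    (fun x : ℝ × ℝ => (inner ℂ (τ (t + x.2)) (γt (s + x.1)) : ℂ)
      - (1 + crossingForm (inner ℂ (deriv τ t) (deriv γt s)) x)) =o[𝓝 0] fun x => ‖x‖ ^ 2 := by
  have hfst : Tendsto (fun x : ℝ × ℝ => x.1) (𝓝 0) (𝓝 0) := continuous_fst.tendsto 0
  have hsnd : Tendsto (fun x : ℝ × ℝ => x.2) (𝓝 0) (𝓝 0) := continuous_snd.tendsto 0
  have hO1 : (fun x : ℝ × ℝ => x.1) =O[𝓝 0] fun x => ‖x‖ :=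
    IsBigO.of_bound 1 (Eventually.of_forall fun x => by simpa using norm_fst_le x)
  have hO2 : (fun x : ℝ × ℝ => x.2) =O[𝓝 0] fun x => ‖x‖ :=
    IsBigO.of_bound 1 (Eventually.of_forall fun x => by simpa using norm_snd_le x)
  have e1 := ((h.isLittleO_inner_self hγ s).comp_tendsto hfst).trans_isBigO (hO1.pow 2)
  have e2 := ((h'.isLittleO_inner_self hσ t).comp_tendsto hsnd).trans_isBigO (hO2.pow 2)
  set a := deriv γt s with ha
  set b := deriv τ t with hb
  have hA : (fun x : ℝ × ℝ => γt (s + x.1) - γt s - x.1 • a) =o[𝓝 0] fun x => ‖x‖ :=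
    ((hasDerivAt_iff_isLittleO_nhds_zero.mp (h.hasDerivAt s)).comp_tendsto hfst).trans_isBigO hO1
  have hB : (fun x : ℝ × ℝ => τ (t + x.2) - τ t - x.2 • b) =o[𝓝 0] fun x => ‖x‖ :=
    ((hasDerivAt_iff_isLittleO_nhds_zero.mp (h'.hasDerivAt t)).comp_tendsto hsnd).trans_isBigO hO2
  have hxa : (fun x : ℝ × ℝ => x.1 • a) =O[𝓝 0] fun x => ‖x‖ :=
    (IsBigO.of_bound ‖a‖ (Eventually.of_forall fun x => by rw [norm_smul, mul_comm])).trans hO1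
  have hxb : (fun x : ℝ × ℝ => x.2 • b) =O[𝓝 0] fun x => ‖x‖ :=
    (IsBigO.of_bound ‖b‖ (Eventually.of_forall fun x => by rw [norm_smul, mul_comm])).trans hO2
  have hA' : (fun x : ℝ × ℝ => γt (s + x.1) - γt s) =O[𝓝 0] fun x => ‖x‖ :=
    (hA.isBigO.add hxa).congr_left fun x => by abel
  have e3 := isLittleO_inner hB hA'
  have e4 := isLittleO_inner hA hxb
  have e2' : (fun x : ℝ × ℝ => (inner ℂ (τ (t + x.2)) (τ t) : ℂ) - (1 - (x.2 : ℂ) ^ 2 / 4))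
      =o[𝓝 0] fun x => ‖x‖ ^ 2 := by
    refine IsLittleO.of_norm_left (e2.norm_left.congr_left fun x => ?_)
    rw [← Complex.norm_conj]
    simp [inner_conj_symm, Complex.conj_ofNat]
  have e4' : (fun x : ℝ × ℝ => (inner ℂ (x.2 • b) (γt (s + x.1) - γt s - x.1 • a) : ℂ))
      =o[𝓝 0] fun x => ‖x‖ ^ 2 := by
    refine IsLittleO.of_norm_left (e4.norm_left.congr (fun x => ?_) fun x => (sq _).symm)
    exact norm_inner_symm _ _
  have e3' := e3.congr_right fun x => (sq ‖x‖).symm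
  refine (((e1.add e2').add e3').add e4').congr_left fun x => ?_
  have hpp : (inner ℂ (τ t) (τ t) : ℂ) = 1 := by
    rw [inner_self_eq_norm_sq_to_K, h'.mem_sphere]; simp
  have hm : (inner ℂ (x.2 • b) (x.1 • a) : ℂ) = inner ℂ b a * ((x.1 * x.2 : ℝ) : ℂ) := by
    rw [← Complex.coe_smul, ← Complex.coe_smul, inner_smul_left, inner_smul_right,
      Complex.conj_ofReal]
    push_cast
    ring
  simp only [Function.comp_apply, crossingForm, hst, inner_sub_left, inner_sub_right, hpp]
  rw [hm]
  push_cast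
  ring

/-- The angle and the orientation at a transversal intersection, from the inner product of the
horizontal velocities. -/
lemma two_mul_inner_eq (hγ : IsArclengthLoop γ T) (hσ : IsArclengthLoop σ S)
    (h : IsParallelLift γ γt) (h' : IsParallelLift σ τ) {s t : ℝ} (hst : γt s = τ t)
    (hli : LinearIndependent ℝ ![deriv γ s, deriv σ t]) :
    let θ := InnerProductGeometry.angle (deriv γ s) (deriv σ t)
    let o := orientationSign (γ s) (deriv γ s) (deriv σ t)
    0 < Real.sin θ ∧ o ^ 2 = 1 ∧ 2 * (inner ℂ (deriv τ t) (deriv γt s) : ℂ).re = Real.cos θ ∧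
      2 * (inner ℂ (deriv τ t) (deriv γt s) : ℂ).im = - (o * Real.sin θ) := by
  intro θ o
  have hp := h.mem_sphere s
  have ha := h.horizontal s
  have hb : inner ℂ (γt s) (deriv τ t) = 0 := by rw [hst]; exact h'.horizontal t
  set a := deriv γt s
  set b := deriv τ t
  have hv : deriv γ s = hopfDeriv (γt s) a := h.deriv_eq s
  have hw : deriv σ t = hopfDeriv (γt s) b := by rw [hst]; exact h'.deriv_eq t
  have hre : (inner ℂ b a : ℂ).re = (inner ℂ a b : ℂ).re := by
    rw [← inner_conj_symm, Complex.conj_re]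
  have him : (inner ℂ b a : ℂ).im = -(inner ℂ a b : ℂ).im := by
    rw [← inner_conj_symm, Complex.conj_im]
  have h2 : √(2 : ℝ) * √2 = 2 := Real.mul_self_sqrt (by norm_num)
  have hcos : Real.cos θ = 2 * (inner ℂ a b : ℂ).re := by
    rw [InnerProductGeometry.cos_angle, hγ.norm_deriv, hσ.norm_deriv, h2, hv, hw,
      inner_hopfDeriv hp ha hb]
    ring
  have hsin : 0 < Real.sin θ := by
    rw [LinearIndependent.pair_iff] at hli
    refine Real.sin_pos_of_pos_of_lt_pi ?_ ?_
    · refine lt_of_le_of_ne (InnerProductGeometry.angle_nonneg _ _) fun h0 => ?_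
      obtain ⟨-, r, -, hr⟩ := InnerProductGeometry.angle_eq_zero_iff.mp h0.symm
      have := (hli r (-1) (by rw [hr]; simp)).2
      norm_num at this
    · refine lt_of_le_of_ne (InnerProductGeometry.angle_le_pi _ _) fun h0 => ?_
      obtain ⟨-, r, -, hr⟩ := InnerProductGeometry.angle_eq_pi_iff.mp h0
      have := (hli r (-1) (by rw [hr]; simp)).2
      norm_num at this
  have hdet : Matrix.det !![γ s 0, γ s 1, γ s 2; deriv γ s 0, deriv γ s 1, deriv γ s 2;
      deriv σ t 0, deriv σ t 1, deriv σ t 2] = 4 * (inner ℂ a b : ℂ).im := by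
    rw [← det_hopfDeriv hp ha hb, ← hv, ← hw, h.hopf_eq]
  have hnorm : (2 * (inner ℂ a b : ℂ).re) ^ 2 + (2 * (inner ℂ a b : ℂ).im) ^ 2 = 1 := by
    have e1 : ‖(inner ℂ a b : ℂ)‖ ^ 2 = 1 / 2 * (1 / 2) := by
      rw [norm_inner_of_horizontal hp ha hb, mul_pow, h.sq_norm_deriv hγ, h'.sq_norm_deriv hσ]
    rw [← Complex.normSq_eq_norm_sq, Complex.normSq_apply] at e1
    linarith
  have hsq : (2 * (inner ℂ a b : ℂ).im) ^ 2 = Real.sin θ ^ 2 := by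
    have := Real.sin_sq_add_cos_sq θ
    rw [hcos] at this
    linarith
  refine ⟨hsin, ?_, by rw [hre, hcos], ?_⟩
  · simp only [o, orientationSign]
    split_ifs <;> norm_num
  · rw [him]
    have ho : o = if 0 < 4 * (inner ℂ a b : ℂ).im then 1 else -1 := by
      simp only [o, orientationSign, hdet]
    rcases sq_eq_sq_iff_eq_or_eq_neg.mp hsq with e | e
    · rw [ho, if_pos (by linarith)]; linarith
    · rw [ho, if_neg (by linarith)]; linarith

/-! ### Shifting the parameter rectangle -/

/-- Shifting both parameter intervals by a small `ε` moves all intersections into the interior of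
the parameter rectangle, without changing them as pairs of parameters. -/
lemma exists_shift (hγ : IsArclengthLoop γ T) (hσ : IsArclengthLoop σ S)
    (hfin : (intersections γ T σ S).Finite) :
    ∃ ε > 0, (∀ x ∈ intersections γ T σ S, x.1 < T - ε ∧ x.2 < S - ε) ∧
      ∀ x : ℝ × ℝ, x.1 ∈ Set.Icc (-ε) (T - ε) → x.2 ∈ Set.Icc (-ε) (S - ε) →
        γ x.1 = σ x.2 → x ∈ intersections γ T σ S := by
  have h1 : ∀ᶠ ε in 𝓝[>] (0 : ℝ), ∀ x ∈ intersections γ T σ S, x.1 < T - ε ∧ x.2 < S - ε := by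
    rw [hfin.eventually_all]
    rintro x ⟨hx1, hx2, -⟩
    have e1 : ∀ᶠ ε in 𝓝 (0 : ℝ), ε < T - x.1 := eventually_lt_nhds (by linarith [hx1.2])
    have e2 : ∀ᶠ ε in 𝓝 (0 : ℝ), ε < S - x.2 := eventually_lt_nhds (by linarith [hx2.2])
    filter_upwards [(e1.and e2).filter_mono nhdsWithin_le_nhds] with ε hε
    constructor <;> linarith [hε.1, hε.2]
  have e1 : ∀ᶠ ε in 𝓝[>] (0 : ℝ), ε < T ∧ ε < S :=
    ((eventually_lt_nhds hγ.length_pos).and (eventually_lt_nhds hσ.length_pos)).filter_mono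
      nhdsWithin_le_nhds
  obtain ⟨ε, ⟨h1, hT, hS⟩, hε⟩ := ((h1.and e1).and self_mem_nhdsWithin).exists
  have hε' : 0 < ε := hε
  refine ⟨ε, hε', h1, ?_⟩
  -- a parameter in `[-ε, 0)` would be equivalent to one in `[T - ε, T)`, where there are none
  have key : ∀ {T u : ℝ}, ε < T → u ∈ Set.Icc (-ε) (T - ε) →
      ∃ u' ∈ Set.Ico 0 T, (u' = u ∨ u' = u + T) ∧ (u' < T - ε → u' = u) := by
    intro T u hT hu
    by_cases h0 : u < 0
    · exact ⟨u + T, ⟨by linarith [hu.1], by linarith⟩, Or.inr rfl, fun h => by linarith [hu.1]⟩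
    · exact ⟨u, ⟨by linarith, by linarith [hu.2]⟩, Or.inl rfl, fun _ => rfl⟩
  rintro ⟨u, v⟩ hu hv huv
  obtain ⟨u', hu', hor, hu''⟩ := key hT hu
  obtain ⟨v', hv', hor', hv''⟩ := key hS hv
  have hγ' : γ u' = γ u := by rcases hor with e | e <;> rw [e]; exact hγ.periodic u
  have hσ' : σ v' = σ v := by rcases hor' with e | e <;> rw [e]; exact hσ.periodic v
  have hmem : (u', v') ∈ intersections γ T σ S := ⟨hu', hv', by rw [hγ', hσ']; exact huv⟩
  have := h1 _ hmem
  rwa [hu'' this.1, hv'' this.2] at hmem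

lemma integral_integral_shift {F : ℝ × ℝ → ℂ} (hF : Continuous F) (hT : 0 < T) (hS : 0 < S)
    (hp1 : ∀ s t, F (s + T, t) = F (s, t)) (hp2 : ∀ s t, F (s, t + S) = F (s, t)) (ε : ℝ) :
    ∫ s in (0 : ℝ)..T, ∫ t in (0 : ℝ)..S, F (s, t)
      = ∫ x in Set.Icc (-ε) (T - ε) ×ˢ Set.Icc (-ε) (S - ε), F x := by
  have e2 : ∀ s, ∫ t in (0 : ℝ)..S, F (s, t) = ∫ t in (-ε)..(S - ε), F (s, t) := by
    intro s
    have h := Function.Periodic.intervalIntegral_add_eq (f := fun t => F (s, t)) (hp2 s) 0 (-ε)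
    rwa [zero_add, neg_add_eq_sub] at h
  have e1 := Function.Periodic.intervalIntegral_add_eq
    (f := fun s => ∫ t in (-ε)..(S - ε), F (s, t)) (T := T)
    (fun s => by simp only [hp1]) 0 (-ε)
  rw [zero_add, neg_add_eq_sub] at e1
  simp only [e2]
  rw [e1, Measure.volume_eq_prod, setIntegral_prod, intervalIntegral.integral_of_le (by linarith),
    integral_Icc_eq_integral_Ioc]
  · congr 1
    ext s
    rw [intervalIntegral.integral_of_le (by linarith), integral_Icc_eq_integral_Ioc]
  · rw [← Measure.volume_eq_prod]
    exact hF.continuousOn.integrableOn_compact (isCompact_Icc.prod isCompact_Icc)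

/-- The kernel `⟨σt(t), γt(s)⟩`, whose `k`-th power is proportional to the inner product of the
coherent states at `γt(s)` and `σt(t)`. -/
def kernel (γt σt : ℝ → C2) (x : ℝ × ℝ) : ℂ := inner ℂ (σt x.2) (γt x.1)

lemma kernel_pow_periodic (hγ : IsArclengthLoop γ T) (hσ : IsArclengthLoop σ S)
    (hγt : IsParallelLift γ γt) (hσt : IsParallelLift σ σt) {k : ℕ}
    (hk : k ∈ bohrSommerfeldOrders γt T) (hk' : k ∈ bohrSommerfeldOrders σt S) (s t : ℝ) :
    kernel γt σt (s + T, t) ^ k = kernel γt σt (s, t) ^ k ∧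
      kernel γt σt (s, t + S) ^ k = kernel γt σt (s, t) ^ k := by
  have h1 : holonomy γt T ^ k = 1 := hk
  have h2 : holonomy σt S ^ k = 1 := hk'
  constructor
  · simp only [kernel]
    rw [(hγt.add_period hγ s).1, inner_smul_right, mul_pow, h1, one_mul]
  · simp only [kernel]
    rw [(hσt.add_period hσ t).1, inner_smul_left, mul_pow, ← map_pow, h2, map_one, one_mul]

end LoopStates

end

open LoopStates MeasureTheory in
theorem theorem4p2
    (γ σ : ℝ → LoopStates.R3) (T S : ℝ) (γt σt : ℝ → LoopStates.C2)
    (hγ : LoopStates.IsArclengthLoop γ T) (hσ : LoopStates.IsArclengthLoop σ S)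
    (hγt : LoopStates.IsParallelLift γ γt) (hσt : LoopStates.IsParallelLift σ σt)
    (hγBS : LoopStates.IsBohrSommerfeld γt T) (hσBS : LoopStates.IsBohrSommerfeld σt S)
    (hfin : (LoopStates.intersections γ T σ S).Finite)
    (htrans : ∀ x ∈ LoopStates.intersections γ T σ S,
      LinearIndependent ℝ ![deriv γ x.1, deriv σ x.2]) :
    Tendsto
      (fun k : ℕ =>
        LoopStates.globalInner (LoopStates.loopState k γt T) (LoopStates.loopState k σt S)
          - ((√2 : ℝ) : ℂ) *
            ∑ x ∈ hfin.toFinset, LoopStates.contribution k γ γt σ σt x.1 x.2)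
      (atTop ⊓ 𝓟 (LoopStates.bohrSommerfeldOrders γt T ∩ LoopStates.bohrSommerfeldOrders σt S))
      (𝓝 0) := by
  obtain ⟨ε, hε, hlt, hmem⟩ := exists_shift hγ hσ hfin
  have hcγ := hγt.contDiff.continuous
  have hcσ := hσt.contDiff.continuous
  have hFc : Continuous (kernel γt σt) := by unfold kernel; fun_prop
  set K : Set (ℝ × ℝ) := Set.Icc (-ε) (T - ε) ×ˢ Set.Icc (-ε) (S - ε) with hK
  set ω : ℝ × ℝ → ℂ := fun x => lineRatio (γt x.1) (σt x.2) with hω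
  set m : ℝ × ℝ → ℂ := fun x =>
    inner ℂ (deriv (fun t => ω x • σt t) x.2) (deriv γt x.1) with hm
  set I : ℝ × ℝ → ℂ := fun x => ∫ h, Complex.exp (crossingForm (m x) h) with hI
  have hphase : ∀ x ∈ hfin.toFinset, γt x.1 = ω x • σt x.2 ∧ ‖ω x‖ = 1 := by
    intro x hx
    have hx' : γ x.1 = σ x.2 := (hfin.mem_toFinset.mp hx).2.2
    exact eq_lineRatio_smul (hγt.mem_sphere _) (hσt.mem_sphere _)
      (by rw [hγt.hopf_eq, hσt.hopf_eq, hx']) (by rw [hγt.hopf_eq]; exact hγ.mem_sphere _)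
  have hcross : ∀ x ∈ hfin.toFinset, |(m x).re| < 1 / 2 ∧ 1 / (2 * (Real.pi : ℂ)) * I x
      = (√2 : ℝ) * (Complex.exp (Complex.I * ((orientationSign (γ x.1) (deriv γ x.1)
          (deriv σ x.2) * (InnerProductGeometry.angle (deriv γ x.1) (deriv σ x.2) / 2
            - Real.pi / 4) : ℝ) : ℂ))
        / ((√(Real.sin (InnerProductGeometry.angle (deriv γ x.1) (deriv σ x.2))) : ℝ) : ℂ)) := by
    intro x hx
    obtain ⟨h1, h2, h3, h4⟩ := two_mul_inner_eq hγ hσ hγt (hσt.smul (hphase x hx).2)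
      (hphase x hx).1 (htrans x (hfin.mem_toFinset.mp hx))
    exact integral_exp_crossingForm_eq (InnerProductGeometry.angle_nonneg _ _)
      (InnerProductGeometry.angle_le_pi _ _) h1 h2 h3 h4
  have hlaplace := tendsto_integral_pow_sub_sum (F := kernel γt σt) (K := K) (Z := hfin.toFinset)
    (ω := ω) (Q := fun x => crossingForm (m x)) hFc (isCompact_Icc.prod isCompact_Icc)
    (by
      intro x hx
      have hx' := hfin.mem_toFinset.mp hx
      rw [hK, interior_prod_eq, interior_Icc, interior_Icc]
      exact ⟨⟨by linarith [hx'.1.1], (hlt x hx').1⟩, ⟨by linarith [hx'.2.1.1], (hlt x hx').2⟩⟩)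
    (by
      intro x hxK hx
      refine norm_inner_lt_one (hγt.mem_sphere _) (hσt.mem_sphere _) fun h => hx ?_
      rw [hγt.hopf_eq, hσt.hopf_eq] at h
      exact hfin.mem_toFinset.mpr (hmem x hxK.1 hxK.2 h))
    (fun x hx => (hphase x hx).2) (fun x _ r h => crossingForm_smul _ r h)
    (fun x hx => ⟨_, by linarith [(hcross x hx).1], crossingForm_re_le (hcross x hx).1⟩)
    (fun x _ => ⟨_, norm_crossingForm_le _⟩)
    (by
      intro x hx
      refine (isLittleO_inner_sub_crossingForm hγ hσ hγt (hσt.smul (hphase x hx).2)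
        (hphase x hx).1).congr_left fun h => ?_
      have hconj : conj (ω x) = (ω x)⁻¹ := by
        rw [Complex.inv_def, Complex.normSq_eq_norm_sq, (hphase x hx).2]; simp
      rw [inner_smul_left, hconj, kernel, inv_mul_eq_div]
      rfl)
  have hinv : Tendsto (fun k : ℕ => (k : ℂ)⁻¹) atTop (𝓝 0) := tendsto_inv_atTop_nhds_zero_nat
  have hsum : Tendsto (fun k : ℕ => (k : ℂ)⁻¹ * ∑ x ∈ hfin.toFinset, ω x ^ k * I x) atTop
      (𝓝 0) := by
    have h1 : Tendsto (fun k : ℕ => ‖(k : ℂ)⁻¹‖ * ∑ x ∈ hfin.toFinset, ‖I x‖) atTop (𝓝 0) := by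
      simpa using hinv.norm.mul_const (∑ x ∈ hfin.toFinset, ‖I x‖)
    refine squeeze_zero_norm (fun k => ?_) h1
    rw [norm_mul]
    refine mul_le_mul_of_nonneg_left ((norm_sum_le _ _).trans_eq ?_) (norm_nonneg _)
    refine Finset.sum_congr rfl fun x hx => ?_
    rw [norm_mul, norm_pow, (hphase x hx).2, one_pow, one_mul]
  -- the prefactor is `(k + 1) / (2π)` rather than `k / (2π)`: the difference tends to zero
  have hlim := ((hlaplace.add (hinv.mul hlaplace)).add hsum).const_mul (1 / (2 * (Real.pi : ℂ)))
  simp only [add_zero, mul_zero] at hlim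
  refine (hlim.mono_left inf_le_left).congr' ?_
  filter_upwards [mem_inf_of_left (eventually_gt_atTop 0), mem_inf_of_right (mem_principal_self _)]
    with k hk hkBS
  have hper := kernel_pow_periodic hγ hσ hγt hσt hkBS.1 hkBS.2
  have hint := integral_integral_shift (F := fun x => kernel γt σt x ^ k) (hFc.pow k)
    hγ.length_pos hσ.length_pos (fun s t => (hper s t).1) (fun s t => (hper s t).2) ε
  have hk0 : (k : ℂ) ≠ 0 := by exact_mod_cast (show 0 < k from hk).ne'
  have hcontr : (√2 : ℝ) * ∑ x ∈ hfin.toFinset, contribution k γ γt σ σt x.1 x.2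
      = 1 / (2 * (Real.pi : ℂ)) * ∑ x ∈ hfin.toFinset, ω x ^ k * I x := by
    rw [Finset.mul_sum, Finset.mul_sum]
    refine Finset.sum_congr rfl fun x hx => ?_
    rw [mul_left_comm _ (ω x ^ k), (hcross x hx).2, contribution]
    ring
  rw [globalInner_loopState k hcγ hcσ, hcontr]
  simp only [kernel] at hint
  rw [hint]
  simp only [← kernel.eq_1, hI]
  generalize (∑ x ∈ hfin.toFinset, ω x ^ k * ∫ h, Complex.exp (crossingForm (m x) h)) = B
  simp only [kernel]
  field_simp
  ring
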